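/- Let $\delta,\alpha_1,\alpha_2,\alpha_3\in\mathbb C$ with $\delta\neq0$ and $2\alpha_j\notin\mathbb Z$, and let $a\in\mathbb C\setminus\{0,1\}$. Let $y$ be meromorphic at $a$ with a pole there, and near $a$ let it solve the sixth Painlevé equation $$y''=\tfrac12\Big(\tfrac1y+\tfrac1{y-1}+\tfrac1{y-x}\Big)y'^2-\Big(\tfrac1x+\tfrac1{x-1}+\tfrac1{y-x}\Big)y'+\tfrac{y(y-1)(y-x)}{x^2(x-1)^2}\Big\{2(\delta-\tfrac12)^2-\tfrac{2\alpha_1^2x}{y^2}+\tfrac{2\alpha_3^2(x-1)}{(y-1)^2}-\tfrac{2(\alpha_2^2-\frac14)x(x-1)}{(y-x)^2}\Big\}.$$ *Associated system.* For $x$ near $a$, $x\neq a$, it is $\Psi_\lambda=A(\lambda,x)\Psi$ with $$A=\frac{1}{\lambda(\lambda-1)(\lambda-x)}\begin{pmatrix}-\delta(\lambda-y)^2+p(\lambda-y)+z&\kappa(\lambda-y)\\ \tilde\kappa(\lambda-\tilde y)&\delta(\lambda-y)^2-p(\lambda-y)-z\end{pmatrix},$$ where $z$ is given by $y'=\frac{y^2-y+2z}{x(x-1)}$,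 $\kappa\neq0$ is any solution of $\frac{\kappa'}{\kappa}=(2\delta-1)\frac{y-x}{x(x-1)}$, and $p,\tilde\kappa,\tilde\kappa\tilde y$ are determined by the condition that the residues of $A$ at $\lambda=0,x,1$ have eigenvalues $\pm\alpha_1,\pm\alpha_2,\pm\alpha_3$. The lower left numerator is read as $\tilde\kappa\lambda-\tilde\kappa\tilde y$ where $\tilde\kappa=0$. For a gauge matrix $R(\lambda)$ with $\det R=1$ write $A^R=RAR^{-1}+R_\lambda R^{-1}$. *Equivalence.* A system $\Psi_\lambda=M\Psi$ is called equivalent, via row $i$ and exponents $(e_1,e_2,e_3)$, to the general Heun equation $$u''+\Big(\tfrac{\gamma}{\lambda}+\tfrac{\varkappa}{\lambda-1}+\tfrac{\epsilon}{\lambda-a}\Big)u'+\frac{\alpha\beta\lambda-q}{\lambda(\lambda-1)(\lambda-a)}u=0,\qquad \gamma+\varkappa+\epsilon=\alpha+\beta+1,$$ if on every open set avoiding $0,1,a$, and for all holomorphic branches of the powers there, $\Psi\mapsto u=\lambda^{e_1}(\lambda-a)^{e_2}(\lambda-1)^{e_3}\Psi_i$ is a bijection from the vector solutions of the system onto the solutions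 of the Heun equation. In all cases below $\gamma=1-2\alpha_1$, $\varkappa=1-2\alpha_3$, $\epsilon=1-2\alpha_2$, and the fourth singular point is the pole $a$. Put $S=\alpha_1+\alpha_2+\alpha_3$ and $$\nu_0(d)=\alpha_1+\alpha_2-(\alpha_1+\alpha_2)^2+\alpha_3^2-d^2+a\big(\alpha_1+\alpha_3-(\alpha_1+\alpha_3)^2+\alpha_2^2-d^2\big).$$ **Theorem.** Limits are taken as $x\to a$ for each fixed $\lambda\ne0,1,a$. Each limit matrix is traceless of the form $M(\lambda)=\frac{1}{\lambda(\lambda-1)(\lambda-a)}N(\lambda)$, with $N_{11}=a_3\lambda^2+b_3\lambda+c_3$, and its residues at $0,a,1$ have eigenvalues $\pm\alpha_1,\pm\alpha_2,\pm\alpha_3$ (with $\alpha_1$ replaced by $\alpha_1-\frac12$ in case (iii)). If $\delta\ne\frac12$, the pole is simple and $y=\sigma\frac{a(a-1)}{2(\delta-1/2)}(x-a)^{-1}+c_0+O(x-a)$ with $\sigma=\pm1$, $c_0\in\mathbb C$. (i) $\sigma=+1$. Then $\kappa/(x-a)\to\kappa_0\ne0$, and $A$ itself converges to a matrix $M$ with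 $a_3=-\delta$, $b_3=c_0(2\delta-1)+1-a$, $$c_3=\tfrac1{2\delta}\big[(\delta-1-c_0(2\delta-1))^2-a\alpha_1^2+(a-1)\alpha_3^2-a(a-1)\alpha_2^2+a(\delta^2-2-2c_0(2\delta^2+\delta-1))+a^2(\delta+1)^2\big],$$ $N_{12}=-\kappa_0\frac{a(a-1)}{2\delta-1}$ and $N_{21}=b_-\lambda+c_-$. This $M$ is equivalent, via row $1$ and exponents $(\alpha_1,\alpha_2,\alpha_3)$, to the Heun equation with $\alpha=\delta-S$, $\beta=2-\delta-S$, $-q=\nu_0(\delta)+b_3(2\delta-1)$. If $\sigma=-1$, then $\kappa\,(x-a)\to\kappa_0\neq0$ and $|A_{12}|\to\infty$. (ii) $\sigma=-1$, $\delta\ne1$. With $$R_0=\begin{pmatrix}\lambda+\frac{1+x-2p-y(2\delta+1)}{2(\delta-1)}&-\frac{\kappa}{2\delta-1}\\ \frac{2\delta-1}{\kappa}&0\end{pmatrix},$$ $A^{R_0}$ converges to a matrix $M$ with $a_3=1-\delta$, $b_3=a-1+c_0(2\delta-1)$, $$c_3=\tfrac1{2(\delta-1)}\big\{a^2[(\delta-2)^2-\alpha_2^2]+a[-\alpha_1^2+\alpha_3^2+\alpha_2^2+(\delta-1)^2-2-c_0(4(\delta-1)^2-2\delta)]-\alpha_3^2+(\delta-c_0(2\delta-1))^2\big\},$$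 $N_{21}=-\frac{a(a-1)(2\delta-1)}{\kappa_0}$ and $N_{12}=b_+\lambda+c_+$. This $M$ is equivalent, via row $2$ and exponents $(\alpha_1,\alpha_2,\alpha_3)$, to the Heun equation with $\alpha=1+\delta-S$, $\beta=1-\delta-S$, $-q=\nu_0(\delta-1)+b_3(2\delta-1)$. (iii) $\sigma=-1$, $\delta=1$. With, for any local branch of $\sqrt\lambda$, $$R_1=\frac1{\sqrt\lambda}\begin{pmatrix}\lambda+g&-\kappa\\-g/\kappa&1\end{pmatrix},\qquad g=-p-y+\frac{z+\alpha_1x}{y},$$ $A^{R_1}$ converges to a matrix $M$ with $a_3=-\frac12$, $b_3=c_0+\frac32a-\frac12$, $c_3=a(\alpha_1-\frac12)$, $N_{21}=-\frac{a(a-1)}{\kappa_0}\lambda$, $N_{12}=b_+\lambda+c_+$, where $$b_+=\tfrac{\kappa_0}{a(a-1)}\big(a^2(1-\alpha_2^2)-a(2+\alpha_1^2-\alpha_3^2-\alpha_2^2-2c_0)-\alpha_3^2+(c_0-1)^2\big),$$ $$c_+=\kappa_0\big(-\alpha_3^2+\alpha_2^2+\tfrac{a+1}{a-1}\alpha_1^2+2\alpha_1(\tfrac{c_0}{a-1}+1)\big).$$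 This $M$ is equivalent, via row $2$ and exponents $(\alpha_1-\frac12,\alpha_2,\alpha_3)$, to the Heun equation with $\alpha=2-S$, $\beta=-S$, $-q=b_3-\frac12(a+1)+\nu_0(0)$. (iv) If $\delta=\frac12$, the pole is double, $(x-a)^2y\to c_{-2}\neq0$, $\kappa\to\kappa_0\ne0$ and $|A_{12}|\to\infty$. With $$R_2=\begin{pmatrix}0&-\frac{2}{\tilde\kappa}\\ \frac{\tilde\kappa}{2}&\lambda-\frac13(2p+2y-2\tilde y+x+1)\end{pmatrix}$$ (defined for $x\ne a$ close to $a$), $A^{R_2}$ converges to a matrix $M$ with $a_3=-\frac32$, $b_3=a+1-\frac{a^2(a-1)^2}{2c_{-2}}$, $$c_3=\tfrac{a^4(a-1)^4}{12c_{-2}^2}+\tfrac{a^2(a-1)^2(a+1)}{6c_{-2}}+\tfrac1{12}\big(a^2(1-4\alpha_2^2)+a(-7-4\alpha_1^2+4\alpha_3^2+4\alpha_2^2)+1-4\alpha_3^2\big),$$ $N_{12}=-\frac{\kappa_0c_{-2}}{a^2(a-1)^2}$ and $N_{21}=b_-\lambda+c_-$. This $M$ is equivalent, via row $1$ and exponents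 $(\alpha_1,\alpha_2,\alpha_3)$, to the Heun equation with $\alpha=\frac32-S$, $\beta=\frac12-S$, $-q=\nu_0(\frac32)+2b_3$. -/

import Mathlib

open Filter Topology

noncomputable section

namespace PVIHeun

/-- `2 × 2` complex matrices. -/
abbrev Mat2 := Matrix (Fin 2) (Fin 2) ℂ

/-! ### The sixth Painlevé equation and the Laurent expansions at its poles -/

/-- The sixth Painlevé equation for `y` at the point `x`, with parameters
`α₀ = 2(δ - 1/2)²`, `β₀ = -2α₁²`, `γ₀ = 2α₃²`, `δ₀ = -2(α₂² - 1/4)`. -/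
def PainleveVI (δ α₁ α₂ α₃ : ℂ) (y : ℂ → ℂ) (x : ℂ) : Prop :=
  deriv (deriv y) x =
    (1 / 2) * (1 / y x + 1 / (y x - 1) + 1 / (y x - x)) * (deriv y x) ^ 2
    - (1 / x + 1 / (x - 1) + 1 / (y x - x)) * deriv y x
    + y x * (y x - 1) * (y x - x) / (x ^ 2 * (x - 1) ^ 2) *
      (2 * (δ - 1 / 2) ^ 2 - 2 * α₁ ^ 2 * (x / (y x) ^ 2)
        + 2 * α₃ ^ 2 * ((x - 1) / (y x - 1) ^ 2)
        - 2 * (α₂ ^ 2 - 1 / 4) * (x * (x - 1) / (y x - x) ^ 2))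

/-- `y(x) = c₋₁ (x-a)⁻¹ + c₀ + o(1)` as `x → a`, with `c₋₁ = σ a(a-1) / (2(δ - 1/2))`. -/
def HasSimplePoleExpansion (δ σ a c₀ : ℂ) (y : ℂ → ℂ) : Prop :=
  Tendsto (fun x => y x - σ * (a * (a - 1) / (2 * (δ - 1 / 2))) / (x - a)) (𝓝[≠] a) (𝓝 c₀)

/-- `y(x) = cd (x-a)⁻² + O((x-a)⁻¹)` as `x → a`, for `y` meromorphic at `a`. -/
def HasDoublePoleExpansion (a cd : ℂ) (y : ℂ → ℂ) : Prop :=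
  Tendsto (fun x => (x - a) ^ 2 * y x) (𝓝[≠] a) (𝓝 cd)

/-! ### Fuchsian systems with singular points `0, 1, x, ∞` -/

/-- The coefficient matrix `N(l) / (l (l-1) (l-x))`. For `N` polynomial of degree at most `2`
in `l` this is `A₁ / l + A₂ / (l - x) + A₃ / (l - 1)` with the residues
`A₁ = N(0) / x`, `A₂ = N(x) / (x (x-1))`, `A₃ = N(1) / (1-x)`. -/
def fuchsMatrix (N : ℂ → Mat2) (x l : ℂ) : Mat2 := (l * (l - 1) * (l - x))⁻¹ • N l

/-- The residue matrices of `fuchsMatrix N x` at `0`, `x`, `1` have the eigenvalues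
`± e₁`, `± e₂`, `± e₃` (with multiplicity). -/
def HasResidueEigenvalues (N : ℂ → Mat2) (x e₁ e₂ e₃ : ℂ) : Prop :=
  (x⁻¹ • N 0).charpoly
      = (Polynomial.X - Polynomial.C e₁) * (Polynomial.X + Polynomial.C e₁) ∧
  ((x * (x - 1))⁻¹ • N x).charpoly
      = (Polynomial.X - Polynomial.C e₂) * (Polynomial.X + Polynomial.C e₂) ∧
  ((1 - x)⁻¹ • N 1).charpoly
      = (Polynomial.X - Polynomial.C e₃) * (Polynomial.X + Polynomial.C e₃)

/-- The traceless numerator with diagonal entry `f₂ l² + f₁ l + f₀`, upper right entry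
`g₁ l + g₀` and lower left entry `h₁ l + h₀`. -/
def numerator (f₂ f₁ f₀ g₁ g₀ h₁ h₀ l : ℂ) : Mat2 :=
  !![f₂ * l ^ 2 + f₁ * l + f₀, g₁ * l + g₀;
     h₁ * l + h₀, -(f₂ * l ^ 2 + f₁ * l + f₀)]

/-! ### The linear system associated with a solution of the sixth Painlevé equation -/

/-- The remaining coefficient functions of the linear system, as functions of `x`. The lower left
entry has numerator `κt(x) l - ω(x)`, that is `κt (l - yt)` with `ω = κt yt`; in this form
it makes sense also where `κt = 0`. -/
structure LaxData where
  z : ℂ → ℂ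
  p : ℂ → ℂ
  κ : ℂ → ℂ
  κt : ℂ → ℂ
  ω : ℂ → ℂ

/-- The zero `yt = ω / κt` of the lower left entry. -/
def LaxData.yt (D : LaxData) (x : ℂ) : ℂ := D.ω x / D.κt x

/-- The numerator
`(-δ(l-y)² + p(l-y) + z) σ₃ + κ(l-y) σ₊ + κt(l-yt) σ₋` of the coefficient matrix. -/
def laxNumerator (δ : ℂ) (y : ℂ → ℂ) (D : LaxData) (x l : ℂ) : Mat2 :=
  !![-δ * (l - y x) ^ 2 + D.p x * (l - y x) + D.z x, D.κ x * (l - y x);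
     D.κt x * l - D.ω x, -(-δ * (l - y x) ^ 2 + D.p x * (l - y x) + D.z x)]

/-- The coefficient matrix `A(l, x)` of the linear system `dΨ/dl = A Ψ`. -/
def laxMatrix (δ : ℂ) (y : ℂ → ℂ) (D : LaxData) (x l : ℂ) : Mat2 :=
  fuchsMatrix (laxNumerator δ y D x) x l

/-- The linear system given by `D` is, for `x` near `a`, `x ≠ a`, the one associated with `y`:
`dy/dx = (y² - y + 2z) / (x(x-1))`, `d(ln κ)/dx = (2δ-1)(y-x) / (x(x-1))`, and the residues of
the coefficient matrix at `l = 0, x, 1` have the eigenvalues `± α₁`, `± α₂`, `± α₃`. -/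
def IsAssociatedSystem (δ α₁ α₂ α₃ a : ℂ) (y : ℂ → ℂ) (D : LaxData) : Prop :=
  ∀ᶠ x in 𝓝[≠] a,
    deriv y x = ((y x) ^ 2 - y x + 2 * D.z x) / (x * (x - 1)) ∧
    D.κ x ≠ 0 ∧
    HasDerivAt D.κ ((2 * δ - 1) * ((y x - x) / (x * (x - 1))) * D.κ x) x ∧
    HasResidueEigenvalues (laxNumerator δ y D x) x α₁ α₂ α₃

/-! ### Schlesinger transformations -/

/-- The gauge transform `R A R⁻¹ + (dR/dl) R⁻¹` of the coefficient matrix `A`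
(`dR/dl` is taken entry by entry). -/
def gaugeTransform (R A : ℂ → Mat2) (l : ℂ) : Mat2 :=
  R l * A l * (R l)⁻¹ + (Matrix.of fun i j => deriv (fun t => R t i j) l) * (R l)⁻¹

/-- The Schlesinger transformation `R₀`, which shifts `δ` to `δ - 1`. -/
def schlesinger₀ (δ : ℂ) (y : ℂ → ℂ) (D : LaxData) (x l : ℂ) : Mat2 :=
  !![l + (1 + x - 2 * D.p x - y x * (2 * δ + 1)) / (2 * (δ - 1)), -(D.κ x / (2 * δ - 1));
     (2 * δ - 1) / D.κ x, 0]

/-- The coefficient `g = -p - y + (z + α₁ x) / y` of the Schlesinger transformation `R₁`. -/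
def schlesingerG₁ (α₁ : ℂ) (y : ℂ → ℂ) (D : LaxData) (x : ℂ) : ℂ :=
  -D.p x - y x + (D.z x + α₁ * x) / y x

/-- The Schlesinger transformation `R₁`, which shifts `δ = 1` to `1/2` and `α₁` to `α₁ - 1/2`;
`s` is a branch of the square root of `l`. -/
def schlesinger₁ (α₁ : ℂ) (y : ℂ → ℂ) (D : LaxData) (s : ℂ → ℂ) (x l : ℂ) : Mat2 :=
  (s l)⁻¹ • !![l + schlesingerG₁ α₁ y D x, -D.κ x;
               -(schlesingerG₁ α₁ y D x / D.κ x), 1]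

/-- `s` is a holomorphic branch of the square root on `U`. -/
def IsSqrtBranch (s : ℂ → ℂ) (U : Set ℂ) : Prop :=
  DifferentiableOn ℂ s U ∧ ∀ l ∈ U, s l ^ 2 = l

/-- The Schlesinger transformation `R₂`, which shifts `δ = 1/2` to `3/2`. -/
def schlesinger₂ (y : ℂ → ℂ) (D : LaxData) (x l : ℂ) : Mat2 :=
  !![0, -(2 / D.κt x);
     D.κt x / 2, l + -(1 / 3) * (2 * D.p x + 2 * y x - 2 * D.yt x + x + 1)]

/-! ### The general Heun equation -/

/-- `u` is a holomorphic solution on `U` of the general Heun equation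
`u'' + (γ/l + κ/(l-1) + ε/(l-a)) u' + (αβ l - q) / (l(l-1)(l-a)) u = 0`. -/
def SolvesHeun (a γ κ ε α β q : ℂ) (U : Set ℂ) (u : ℂ → ℂ) : Prop :=
  DifferentiableOn ℂ u U ∧
  ∀ l ∈ U, deriv (deriv u) l + (γ / l + κ / (l - 1) + ε / (l - a)) * deriv u l
    + (α * β * l - q) / (l * (l - 1) * (l - a)) * u l = 0

/-- `Ψ` is a holomorphic (vector) solution on `U` of `dΨ/dl = M(l) Ψ`. -/
def SolvesSystem (M : ℂ → Mat2) (U : Set ℂ) (Ψ : ℂ → Fin 2 → ℂ) : Prop :=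
  ∀ l ∈ U, HasDerivAt Ψ (Matrix.mulVec (M l) (Ψ l)) l

/-- `L` is a holomorphic branch of `log (l - c)` on `U`. -/
def IsLogBranch (c : ℂ) (L : ℂ → ℂ) (U : Set ℂ) : Prop :=
  DifferentiableOn ℂ L U ∧ ∀ l ∈ U, Complex.exp (L l) = l - c

/-- The system `dΨ/dl = M(l) Ψ` is equivalent to the general Heun equation with singular points
`0, 1, a, ∞` and parameters `γ, κ, ε, α, β, q`, by elimination of the other entry of `Ψ`:
on every open set `U` avoiding `0, 1, a`, and for all branches of the powers there,
`u = l ^ e₁ (l - a) ^ e₂ (l - 1) ^ e₃ Ψ_row` is a bijection from the solutions of the system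
on `U` onto the solutions of the Heun equation on `U`. -/
def EquivalentToHeun (M : ℂ → Mat2) (row : Fin 2) (e₁ e₂ e₃ a γ κ ε α β q : ℂ) : Prop :=
  a ≠ 0 ∧ a ≠ 1 ∧ γ + κ + ε = α + β + 1 ∧
  ∀ (U : Set ℂ) (L₁ L₂ L₃ : ℂ → ℂ), IsOpen U → 0 ∉ U → 1 ∉ U → a ∉ U →
    IsLogBranch 0 L₁ U → IsLogBranch a L₂ U → IsLogBranch 1 L₃ U →
    (∀ Ψ, SolvesSystem M U Ψ → SolvesHeun a γ κ ε α β q U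
      (fun l => Complex.exp (e₁ * L₁ l + e₂ * L₂ l + e₃ * L₃ l) * Ψ l row)) ∧
    (∀ u, SolvesHeun a γ κ ε α β q U u → ∃ Ψ, SolvesSystem M U Ψ ∧
      ∀ l ∈ U, u l = Complex.exp (e₁ * L₁ l + e₂ * L₂ l + e₃ * L₃ l) * Ψ l row) ∧
    (∀ Ψ Φ, SolvesSystem M U Ψ → SolvesSystem M U Φ →
      (∀ l ∈ U, Ψ l row = Φ l row) → ∀ l ∈ U, Ψ l = Φ l)

/-- The part of the accessory parameter that depends only on `a`, the local exponents
and the formal exponent `d` at infinity. -/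
def accessoryBase (α₁ α₂ α₃ a d : ℂ) : ℂ :=
  α₁ + α₂ - (α₁ + α₂) ^ 2 + α₃ ^ 2 - d ^ 2
    + a * (α₁ + α₃ - (α₁ + α₃) ^ 2 + α₂ ^ 2 - d ^ 2)

end PVIHeun

end

open PVIHeun

namespace PVIHeun

/-! Eliminating the second component from the linear system gives a scalar equation with the
singular points `0, 1, x, ∞` and an apparent singularity at `λ = y`, the zero of the upper right
entry `κ (λ - y)`. At a pole of `y` the apparent singularity runs off to infinity. If an
off-diagonal numerator tends to a nonzero constant, the limit system has no apparent singularity and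
its scalar equation is a Heun equation.

Balancing the leading terms of the Painlevé equation shows that the pole is simple with leading
coefficient `± a(a-1)/(2δ-1)` when `δ ≠ 1/2`, and double when `δ = 1/2` (`painleveVI_pole`). The
logarithmic derivative of `κ` then has residue `σ` at `a` for a simple pole, and it is zero for `δ =
1/2`. So `κ y` is bounded only for `σ = 1`. Otherwise a Schlesinger transformation changes the
formal exponent at infinity and produces a well-behaved off-diagonal entry: the old upper right
entry, divided by a multiple of `κ²`, moves to the lower left for `R₀`; the old lower left entry
moves to the upper right for `R₂`. For `δ = 1` the exponent after `R₀` would be zero; there `R₁`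
yields a lower left entry whose limit is a multiple of `λ`, so its only zero is the singular point
`0`.

Convergence is algebra with the residue conditions. By tracelessness they are three scalar
relations, at the nodes `0, 1, x`, for the quartic `N₁₁² + N₁₂ N₂₁`. Once one off-diagonal entry `G
(1 - ηλ)` is known, dividing the relations by `1 - ηλ` and taking the second divided difference over
the nodes removes the other, linear, entry. Only the limits of `G`, `η` and `B + η C` are then
needed, where `N₁₁ = -e λ² + B λ + C` (`tendsto_of_tendsto_const_entry`). For simple poles `p` drops
out of `B + η C`, and the first two Laurent coefficients of `y` suffice. For `δ = 1` and for double
poles `p` itself is expanded by means of `formula_p`.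

The Heun parameters come from the same quartic: its values at the three singular points and its two
top coefficients determine it, so the accessory parameter depends only on `a`, the exponents and the
linear coefficient of `N₁₁`. -/

/-! ### Elimination of one component: from traceless systems to the Heun equation. -/

theorem mulVec_apply_of_ne (M : Mat2) (v : Fin 2 → ℂ) {i j : Fin 2} (hij : i ≠ j) (k : Fin 2) :
    Matrix.mulVec M v k = M k i * v i + M k j * v j := by
  fin_cases i <;> fin_cases j <;>
    simp_all [Matrix.mulVec, dotProduct, Fin.sum_univ_two, add_comm]

theorem solvesSystem_iff {M : ℂ → Mat2} {U : Set ℂ} {Ψ : ℂ → Fin 2 → ℂ} {i j : Fin 2}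
    (hij : i ≠ j) :
    SolvesSystem M U Ψ ↔ ∀ l ∈ U,
      HasDerivAt (fun t => Ψ t i) (M l i i * Ψ l i + M l i j * Ψ l j) l ∧
      HasDerivAt (fun t => Ψ t j) (M l j i * Ψ l i + M l j j * Ψ l j) l := by
  refine forall₂_congr fun l _ => ?_
  rw [hasDerivAt_pi]
  simp only [mulVec_apply_of_ne _ _ hij]
  refine ⟨fun h => ⟨h i, h j⟩, fun h k => ?_⟩
  have hk : k = i ∨ k = j := by clear * - hij; revert hij; revert i j k; decide
  rcases hk with rfl | rfl
  exacts [h.1, h.2]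

theorem IsLogBranch.hasDerivAt {c : ℂ} {L : ℂ → ℂ} {U : Set ℂ} (h : IsLogBranch c L U)
    (hU : IsOpen U) {l : ℂ} (hl : l ∈ U) : HasDerivAt L (1 / (l - c)) l := by
  have hd := (h.1.differentiableAt (hU.mem_nhds hl)).hasDerivAt
  have h1 := hd.cexp
  have h2 : HasDerivAt (fun t => Complex.exp (L t)) 1 l :=
    ((hasDerivAt_id l).sub_const c).congr_of_eventuallyEq
      (by filter_upwards [hU.mem_nhds hl] with t ht using h.2 t ht)
  have h3 := h1.unique h2
  have h4 := h.2 l hl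
  have h5 : l - c ≠ 0 := h4 ▸ Complex.exp_ne_zero _
  rw [h4] at h3
  rwa [show 1 / (l - c) = deriv L l by field_simp; linear_combination -h3]

/-- Elimination of the other entry from a traceless system. Here `m`, `G`, `H` are the entries of
the coefficient matrix, `dG/dl = G g`, and `e` is the logarithmic derivative of the multiplier. -/
theorem equivalentToHeun_of_elimination {M : ℂ → Mat2} {i j : Fin 2} (hij : i ≠ j)
    {e₁ e₂ e₃ a γ κ ε α β q : ℂ} (ha₀ : a ≠ 0) (ha₁ : a ≠ 1) (hsum : γ + κ + ε = α + β + 1)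
    (m m' G g H : ℂ → ℂ)
    (hM : ∀ l, M l i i = m l ∧ M l i j = G l ∧ M l j i = H l ∧ M l j j = -m l)
    (hG : ∀ l, l ≠ 0 → l ≠ 1 → l ≠ a → G l ≠ 0)
    (hm' : ∀ l, l ≠ 0 → l ≠ 1 → l ≠ a → HasDerivAt m (m' l) l)
    (hG' : ∀ l, l ≠ 0 → l ≠ 1 → l ≠ a → HasDerivAt G (G l * g l) l)
    (hP : ∀ l, l ≠ 0 → l ≠ 1 → l ≠ a → γ / l + κ / (l - 1) + ε / (l - a)
      = -g l - 2 * (e₁ / l + e₂ / (l - a) + e₃ / (l - 1)))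
    (hQ : ∀ l, l ≠ 0 → l ≠ 1 → l ≠ a → (α * β * l - q) / (l * (l - 1) * (l - a))
      = -m' l + m l * g l - G l * H l - m l ^ 2
        + (e₁ / l + e₂ / (l - a) + e₃ / (l - 1)) ^ 2
        + (e₁ / l ^ 2 + e₂ / (l - a) ^ 2 + e₃ / (l - 1) ^ 2)
        + (e₁ / l + e₂ / (l - a) + e₃ / (l - 1)) * g l) :
    EquivalentToHeun M i e₁ e₂ e₃ a γ κ ε α β q := by
  refine ⟨ha₀, ha₁, hsum, fun U L₁ L₂ L₃ hU h0 h1 ha hL₁ hL₂ hL₃ => ?_⟩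
  set E : ℂ → ℂ := fun l => Complex.exp (e₁ * L₁ l + e₂ * L₂ l + e₃ * L₃ l) with hEdef
  set e : ℂ → ℂ := fun l => e₁ / l + e₂ / (l - a) + e₃ / (l - 1) with hedef
  have hE0 : ∀ l, E l ≠ 0 := fun l => Complex.exp_ne_zero _
  have ne : ∀ l ∈ U, l ≠ 0 ∧ l ≠ 1 ∧ l ≠ a := fun l hl =>
    ⟨fun h => h0 (h ▸ hl), fun h => h1 (h ▸ hl), fun h => ha (h ▸ hl)⟩
  have hE' : ∀ l ∈ U, HasDerivAt E (E l * e l) l := by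
    intro l hl
    have := ((((hL₁.hasDerivAt hU hl).const_mul e₁).add
      ((hL₂.hasDerivAt hU hl).const_mul e₂)).add ((hL₃.hasDerivAt hU hl).const_mul e₃)).cexp
    refine this.congr_deriv ?_
    simp only [hEdef, hedef, Pi.add_apply, sub_zero]
    ring
  have he' : ∀ l ∈ U, HasDerivAt e
      (-(e₁ / l ^ 2 + e₂ / (l - a) ^ 2 + e₃ / (l - 1) ^ 2)) l := by
    intro l hl
    obtain ⟨n0, n1, na⟩ := ne l hl
    have d0 := (hasDerivAt_const l e₁).fun_div (hasDerivAt_id' l) n0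
    have d1 := (hasDerivAt_const l e₃).fun_div ((hasDerivAt_id' l).sub_const 1) (sub_ne_zero.2 n1)
    have da := (hasDerivAt_const l e₂).fun_div ((hasDerivAt_id' l).sub_const a) (sub_ne_zero.2 na)
    exact ((d0.fun_add da).fun_add d1).congr_deriv (by ring)
  refine ⟨fun Ψ hΨ => ?_, fun u hu => ?_, fun Ψ Φ hΨ hΦ h l hl => ?_⟩
  · rw [solvesSystem_iff hij] at hΨ
    have hd1 : ∀ l ∈ U, HasDerivAt (fun t => E t * Ψ t i)
        (E l * ((e l + m l) * Ψ l i + G l * Ψ l j)) l := by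
      intro l hl
      refine ((hE' l hl).mul (hΨ l hl).1).congr_deriv ?_
      rw [(hM l).1, (hM l).2.1]; ring
    refine ⟨fun l hl => (hd1 l hl).differentiableAt.differentiableWithinAt, fun l hl => ?_⟩
    obtain ⟨n0, n1, na⟩ := ne l hl
    have hev : deriv (fun t => E t * Ψ t i) =ᶠ[𝓝 l]
        fun t => E t * ((e t + m t) * Ψ t i + G t * Ψ t j) := by
      filter_upwards [hU.mem_nhds hl] with t ht using (hd1 t ht).deriv
    have hd2 := (hE' l hl).fun_mul (((((he' l hl).fun_add (hm' l n0 n1 na)).fun_mul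
      (hΨ l hl).1)).fun_add ((hG' l n0 n1 na).fun_mul (hΨ l hl).2))
    change deriv (deriv (fun t => E t * Ψ t i)) l + _ * deriv (fun t => E t * Ψ t i) l
      + _ * (E l * Ψ l i) = 0
    rw [hev.deriv_eq, hd2.deriv, (hd1 l hl).deriv, hP l n0 n1 na, hQ l n0 n1 na,
      (hM l).1, (hM l).2.1, (hM l).2.2.1, (hM l).2.2.2]
    simp only [hedef]
    ring
  · have hu1 : ∀ l ∈ U, HasDerivAt u (deriv u l) l := fun l hl =>
      (hu.1.differentiableAt (hU.mem_nhds hl)).hasDerivAt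
    have hu2 : ∀ l ∈ U, HasDerivAt (deriv u) (deriv (deriv u) l) l := fun l hl =>
      ((hu.1.deriv hU).differentiableAt (hU.mem_nhds hl)).hasDerivAt
    -- The missing component is read off from the first equation of the system, which can be solved
    -- for it because `G` has no zero on `U`. The Heun equation then becomes the second equation.
    let v : ℂ → ℂ := fun t => (deriv u t - (e t + m t) * u t) / (E t * G t)
    refine ⟨fun t k => if k = i then u t / E t else v t, ?_, fun l hl => ?_⟩
    · rw [solvesSystem_iff hij]
      intro l hl
      obtain ⟨n0, n1, na⟩ := ne l hl
      have hG0 := hG l n0 n1 na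
      have hEl := hE0 l
      simp only [if_true, if_neg hij.symm, (hM l).1, (hM l).2.1, (hM l).2.2.1, (hM l).2.2.2]
      constructor
      · refine ((hu1 l hl).fun_div (hE' l hl) hEl).congr_deriv ?_
        simp only [v]
        field_simp
        ring
      · refine (((hu2 l hl).fun_sub (((he' l hl).fun_add (hm' l n0 n1 na)).fun_mul
          (hu1 l hl))).fun_div ((hE' l hl).fun_mul (hG' l n0 n1 na))
          (mul_ne_zero hEl hG0)).congr_deriv ?_
        have hode := hu.2 l hl
        rw [hP l n0 n1 na, hQ l n0 n1 na] at hode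
        change _ + (-g l - 2 * e l) * _ + (_ + e l ^ 2 + _ + e l * g l) * _ = 0 at hode
        simp only [v]
        generalize (e₁ / l ^ 2 + e₂ / (l - a) ^ 2 + e₃ / (l - 1) ^ 2) = e' at hode ⊢
        field_simp
        linear_combination hode
    · change u l = E l * (if i = i then u l / E l else v l)
      have hEl := hE0 l
      rw [if_pos rfl]
      field_simp
  · rw [solvesSystem_iff hij] at hΨ hΦ
    obtain ⟨n0, n1, na⟩ := ne l hl
    have h1 : HasDerivAt (fun t => Ψ t i) (M l i i * Φ l i + M l i j * Φ l j) l :=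
      (hΦ l hl).1.congr_of_eventuallyEq
        (by filter_upwards [hU.mem_nhds hl] with t ht using h t ht)
    have h2 := h1.unique (hΨ l hl).1
    rw [h l hl, (hM l).2.1] at h2
    have h3 : Ψ l j = Φ l j := mul_left_cancel₀ (hG l n0 n1 na) (by linear_combination -h2)
    funext k
    have hk : k = i ∨ k = j := by clear * - hij; revert hij; revert i j k; decide
    rcases hk with rfl | rfl
    exacts [h l hl, h3]

theorem hasDerivAt_cubic (a l : ℂ) : HasDerivAt (fun t : ℂ => t * (t - 1) * (t - a))
    ((l - 1) * (l - a) + l * (l - a) + l * (l - 1)) l :=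
  (((hasDerivAt_id' l).fun_mul ((hasDerivAt_id' l).sub_const 1)).fun_mul
    ((hasDerivAt_id' l).sub_const a)).congr_deriv (by ring)

theorem cubic_ne_zero {a l : ℂ} (h0 : l ≠ 0) (h1 : l ≠ 1) (ha : l ≠ a) :
    l * (l - 1) * (l - a) ≠ 0 :=
  mul_ne_zero (mul_ne_zero h0 (sub_ne_zero.2 h1)) (sub_ne_zero.2 ha)

/-- The system with a constant off-diagonal entry `g` of the numerator. -/
theorem equivalentToHeun_of_const {N : ℂ → Mat2} {i j : Fin 2} (hij : i ≠ j)
    {e₁ e₂ e₃ a d b c g h₁ h₀ α β q : ℂ} (ha₀ : a ≠ 0) (ha₁ : a ≠ 1) (hg : g ≠ 0)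
    (hN : ∀ l, N l i i = -d * l ^ 2 + b * l + c ∧ N l i j = g ∧ N l j i = h₁ * l + h₀ ∧
      N l j j = -(-d * l ^ 2 + b * l + c))
    (r₀ : c ^ 2 + g * h₀ = e₁ ^ 2 * a ^ 2)
    (r₁ : (-d + b + c) ^ 2 + g * (h₁ + h₀) = e₃ ^ 2 * (1 - a) ^ 2)
    (ra : (-d * a ^ 2 + b * a + c) ^ 2 + g * (h₁ * a + h₀) = e₂ ^ 2 * (a * (a - 1)) ^ 2)
    (hsum : α + β = 2 - 2 * (e₁ + e₂ + e₃))
    (hprod : α * β = (d - (e₁ + e₂ + e₃)) * (2 - d - (e₁ + e₂ + e₃)))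
    (hq : q = -(accessoryBase e₁ e₂ e₃ a d + b * (2 * d - 1))) :
    EquivalentToHeun (fuchsMatrix N a) i e₁ e₂ e₃ a (1 - 2 * e₁) (1 - 2 * e₃) (1 - 2 * e₂)
      α β q := by
  refine equivalentToHeun_of_elimination hij ha₀ ha₁ (by rw [hsum]; ring)
    (fun l => (-d * l ^ 2 + b * l + c) / (l * (l - 1) * (l - a)))
    (fun l => ((-2 * d * l + b) * (l * (l - 1) * (l - a)) - (-d * l ^ 2 + b * l + c) *
      ((l - 1) * (l - a) + l * (l - a) + l * (l - 1))) / (l * (l - 1) * (l - a)) ^ 2)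
    (fun l => g / (l * (l - 1) * (l - a)))
    (fun l => -(1 / l + 1 / (l - 1) + 1 / (l - a)))
    (fun l => (h₁ * l + h₀) / (l * (l - 1) * (l - a))) ?_ ?_ ?_ ?_ ?_ ?_
  · intro l
    obtain ⟨h1, h2, h3, h4⟩ := hN l
    simp only [fuchsMatrix, Matrix.smul_apply, h1, h2, h3, h4, smul_eq_mul]
    refine ⟨?_, ?_, ?_, ?_⟩ <;> ring
  · exact fun l h0 h1 ha => div_ne_zero hg (cubic_ne_zero h0 h1 ha)
  · intro l h0 h1 ha
    have hd : HasDerivAt (fun l => -d * l ^ 2 + b * l + c) (-2 * d * l + b) l :=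
      (((((hasDerivAt_id' l).fun_pow 2).const_mul (-d)).fun_add
        ((hasDerivAt_id' l).const_mul b)).add_const c).congr_deriv (by norm_num; ring)
    exact hd.fun_div (hasDerivAt_cubic a l) (cubic_ne_zero h0 h1 ha)
  · intro l h0 h1 ha
    have h1' := sub_ne_zero.2 h1
    have ha' := sub_ne_zero.2 ha
    refine ((hasDerivAt_const l g).fun_div (hasDerivAt_cubic a l)
      (cubic_ne_zero h0 h1 ha)).congr_deriv ?_
    field_simp
    ring
  · intro l h0 h1 ha
    ring
  · intro l h0 h1 ha
    have h1' := sub_ne_zero.2 h1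
    have ha' := sub_ne_zero.2 ha
    have ha1' := sub_ne_zero.2 ha₁
    rw [hprod, hq, accessoryBase]
    -- Lagrange interpolation of a quartic at `0, 1, a`: the remainder is the cubic times a linear
    -- factor fixed by the coefficients of `l⁴` and `l³`, to which `g (h₁ l + h₀)` does not
    -- contribute.
    have key : (-d * l ^ 2 + b * l + c) ^ 2 + g * (h₁ * l + h₀) =
        e₁ ^ 2 * a * ((l - 1) * (l - a)) + e₃ ^ 2 * (1 - a) * (l * (l - a))
        + e₂ ^ 2 * (a * (a - 1)) * (l * (l - 1))
        + l * (l - 1) * (l - a) * (d ^ 2 * (l + 1 + a) - 2 * d * b) := by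
      have : a * (a - 1) * ((-d * l ^ 2 + b * l + c) ^ 2 + g * (h₁ * l + h₀)) =
        a * (a - 1) * (e₁ ^ 2 * a * ((l - 1) * (l - a)) + e₃ ^ 2 * (1 - a) * (l * (l - a))
        + e₂ ^ 2 * (a * (a - 1)) * (l * (l - 1))
        + l * (l - 1) * (l - a) * (d ^ 2 * (l + 1 + a) - 2 * d * b)) := by
        linear_combination (a - 1) * ((l - 1) * (l - a)) * r₀ - a * (l * (l - a)) * r₁
          + l * (l - 1) * ra
      exact mul_left_cancel₀ (mul_ne_zero ha₀ ha1') this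
    field_simp
    linear_combination key

/-- The system with an off-diagonal entry of the numerator that vanishes at `0` only. -/
theorem equivalentToHeun_of_linear {N : ℂ → Mat2} {i j : Fin 2} (hij : i ≠ j)
    {e₁ e₂ e₃ a d b c g h₁ h₀ α β q : ℂ} (ha₀ : a ≠ 0) (ha₁ : a ≠ 1) (hg : g ≠ 0)
    (hN : ∀ l, N l i i = -d * l ^ 2 + b * l + c ∧ N l i j = g * l ∧ N l j i = h₁ * l + h₀ ∧
      N l j j = -(-d * l ^ 2 + b * l + c))
    (r₀ : c = -(e₁ * a))
    (r₁ : (-d + b + c) ^ 2 + g * (h₁ + h₀) = e₃ ^ 2 * (1 - a) ^ 2)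
    (ra : (-d * a ^ 2 + b * a + c) ^ 2 + g * a * (h₁ * a + h₀) = e₂ ^ 2 * (a * (a - 1)) ^ 2)
    (hsum : α + β = 1 - 2 * (e₁ + e₂ + e₃))
    (hprod : α * β = (d - (e₁ + e₂ + e₃)) * (1 - d - (e₁ + e₂ + e₃)))
    (hq : q = -(2 * d * b - d ^ 2 * (1 + a) - (e₁ + e₂) ^ 2 - a * (e₁ + e₃) ^ 2 + e₃ ^ 2
      + a * e₂ ^ 2)) :
    EquivalentToHeun (fuchsMatrix N a) i e₁ e₂ e₃ a (-2 * e₁) (1 - 2 * e₃) (1 - 2 * e₂)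
      α β q := by
  refine equivalentToHeun_of_elimination hij ha₀ ha₁ (by rw [hsum]; ring)
    (fun l => (-d * l ^ 2 + b * l + c) / (l * (l - 1) * (l - a)))
    (fun l => ((-2 * d * l + b) * (l * (l - 1) * (l - a)) - (-d * l ^ 2 + b * l + c) *
      ((l - 1) * (l - a) + l * (l - a) + l * (l - 1))) / (l * (l - 1) * (l - a)) ^ 2)
    (fun l => g * l / (l * (l - 1) * (l - a)))
    (fun l => -(1 / (l - 1) + 1 / (l - a)))
    (fun l => (h₁ * l + h₀) / (l * (l - 1) * (l - a))) ?_ ?_ ?_ ?_ ?_ ?_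
  · intro l
    obtain ⟨h1, h2, h3, h4⟩ := hN l
    simp only [fuchsMatrix, Matrix.smul_apply, h1, h2, h3, h4, smul_eq_mul]
    refine ⟨?_, ?_, ?_, ?_⟩ <;> ring
  · exact fun l h0 h1 ha => div_ne_zero (mul_ne_zero hg h0) (cubic_ne_zero h0 h1 ha)
  · intro l h0 h1 ha
    have hd : HasDerivAt (fun l => -d * l ^ 2 + b * l + c) (-2 * d * l + b) l :=
      (((((hasDerivAt_id' l).fun_pow 2).const_mul (-d)).fun_add
        ((hasDerivAt_id' l).const_mul b)).add_const c).congr_deriv (by norm_num; ring)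
    exact hd.fun_div (hasDerivAt_cubic a l) (cubic_ne_zero h0 h1 ha)
  · intro l h0 h1 ha
    have h1' := sub_ne_zero.2 h1
    have ha' := sub_ne_zero.2 ha
    refine (((hasDerivAt_id' l).const_mul g).fun_div (hasDerivAt_cubic a l)
      (cubic_ne_zero h0 h1 ha)).congr_deriv ?_
    field_simp
    ring
  · intro l h0 h1 ha
    ring
  · intro l h0 h1 ha
    have h1' := sub_ne_zero.2 h1
    have ha' := sub_ne_zero.2 ha
    have ha1' := sub_ne_zero.2 ha₁
    -- The sign in `r₀` matters: `g l` cancels the pole of the logarithmic derivative at `0`, and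
    -- the double pole of the zeroth-order coefficient there vanishes for `c = -e₁ a`, but in
    -- general not for `c = e₁ a`.
    rw [hprod, hq, r₀]
    rw [r₀] at r₁ ra
    have key : (-d * l ^ 2 + b * l + -(e₁ * a)) ^ 2 + g * l * (h₁ * l + h₀) =
        e₁ ^ 2 * a * ((l - 1) * (l - a)) + e₃ ^ 2 * (1 - a) * (l * (l - a))
        + e₂ ^ 2 * (a * (a - 1)) * (l * (l - 1))
        + l * (l - 1) * (l - a) * (d ^ 2 * (l + 1 + a) - 2 * d * b) := by
      have : a * (a - 1) * ((-d * l ^ 2 + b * l + -(e₁ * a)) ^ 2 + g * l * (h₁ * l + h₀)) =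
        a * (a - 1) * (e₁ ^ 2 * a * ((l - 1) * (l - a)) + e₃ ^ 2 * (1 - a) * (l * (l - a))
        + e₂ ^ 2 * (a * (a - 1)) * (l * (l - 1))
        + l * (l - 1) * (l - a) * (d ^ 2 * (l + 1 + a) - 2 * d * b)) := by
        linear_combination -a * (l * (l - a)) * r₁ + l * (l - 1) * ra
      exact mul_left_cancel₀ (mul_ne_zero ha₀ ha1') this
    field_simp
    linear_combination key

/-! ### Residue eigenvalues -/

theorem charpoly_eq_iff_of_traceless {M : Mat2} (hM : M 1 1 = -M 0 0) (e : ℂ) :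
    M.charpoly = (Polynomial.X - Polynomial.C e) * (Polynomial.X + Polynomial.C e) ↔
      M 0 0 ^ 2 + M 0 1 * M 1 0 = e ^ 2 := by
  have h1 : M.charpoly = Polynomial.X ^ 2 - Polynomial.C (M 0 0 ^ 2 + M 0 1 * M 1 0) := by
    rw [Matrix.charpoly_fin_two, Matrix.trace_fin_two, Matrix.det_fin_two, hM]
    simp only [map_add, map_sub, map_mul, map_neg, map_pow]
    ring
  have h2 : (Polynomial.X - Polynomial.C e) * (Polynomial.X + Polynomial.C e)
      = Polynomial.X ^ 2 - Polynomial.C (e ^ 2) := by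
    simp only [map_pow]; ring
  rw [h1, h2, sub_right_inj, Polynomial.C_inj]

/-- Each residue is traceless, so only its determinant matters. From here on the eigenvalue
conditions are used as three polynomial relations. -/
theorem hasResidueEigenvalues_iff {f₂ f₁ f₀ g₁ g₀ h₁ h₀ x e₁ e₂ e₃ : ℂ}
    (hx₀ : x ≠ 0) (hx₁ : x ≠ 1) :
    HasResidueEigenvalues (numerator f₂ f₁ f₀ g₁ g₀ h₁ h₀) x e₁ e₂ e₃ ↔
      f₀ ^ 2 + g₀ * h₀ = e₁ ^ 2 * x ^ 2 ∧
      (f₂ * x ^ 2 + f₁ * x + f₀) ^ 2 + (g₁ * x + g₀) * (h₁ * x + h₀)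
        = e₂ ^ 2 * (x * (x - 1)) ^ 2 ∧
      (f₂ + f₁ + f₀) ^ 2 + (g₁ + g₀) * (h₁ + h₀) = e₃ ^ 2 * (1 - x) ^ 2 := by
  have h1 : x - 1 ≠ 0 := sub_ne_zero.2 hx₁
  have h1' : 1 - x ≠ 0 := sub_ne_zero.2 hx₁.symm
  have key : ∀ {c : ℂ}, c ≠ 0 → ∀ (l e : ℂ),
      (c⁻¹ • numerator f₂ f₁ f₀ g₁ g₀ h₁ h₀ l).charpoly
        = (Polynomial.X - Polynomial.C e) * (Polynomial.X + Polynomial.C e) ↔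
      (f₂ * l ^ 2 + f₁ * l + f₀) ^ 2 + (g₁ * l + g₀) * (h₁ * l + h₀) = e ^ 2 * c ^ 2 := by
    intro c hc l e
    rw [charpoly_eq_iff_of_traceless (by simp [numerator]; ring)]
    simp only [numerator, Matrix.smul_apply, smul_eq_mul, Matrix.of_apply, Matrix.cons_val',
      Matrix.cons_val_zero, Matrix.cons_val_one, Matrix.cons_val_fin_one]
    constructor
    · intro h
      rw [← h]
      field_simp
    · intro h
      have h2 := h
      field_simp
      linear_combination h2
  unfold HasResidueEigenvalues
  rw [key hx₀, key (mul_ne_zero hx₀ h1), key h1']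
  simp

theorem laxNumerator_eq (δ : ℂ) (y : ℂ → ℂ) (D : LaxData) (x : ℂ) :
    laxNumerator δ y D x = numerator (-δ) (2 * δ * y x + D.p x)
      (-δ * y x ^ 2 - D.p x * y x + D.z x) (D.κ x) (-(D.κ x * y x)) (D.κt x) (-D.ω x) := by
  funext l
  ext i j
  fin_cases i <;> fin_cases j <;> simp [laxNumerator, numerator] <;> ring

/-! ### Limits -/

theorem eventually_ne_nhdsNE (a c : ℂ) : ∀ᶠ x in 𝓝[≠] a, x ≠ c := by
  rcases eq_or_ne a c with rfl | h
  · exact eventually_mem_nhdsWithin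
  · exact eventually_nhdsWithin_of_eventually_nhds (eventually_ne_nhds h)

theorem tendsto_id_nhdsNE (a : ℂ) : Tendsto (fun x : ℂ => x) (𝓝[≠] a) (𝓝 a) :=
  tendsto_nhdsWithin_of_tendsto_nhds tendsto_id

theorem tendsto_fuchsMatrix_numerator {a l : ℂ} (h0 : l ≠ 0) (h1 : l ≠ 1) (ha : l ≠ a)
    {f₂ f₁ f₀ g₁ g₀ h₁ h₀ : ℂ → ℂ} {f₂' f₁' f₀' g₁' g₀' h₁' h₀' : ℂ}
    (hf₂ : Tendsto f₂ (𝓝[≠] a) (𝓝 f₂')) (hf₁ : Tendsto f₁ (𝓝[≠] a) (𝓝 f₁'))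
    (hf₀ : Tendsto f₀ (𝓝[≠] a) (𝓝 f₀')) (hg₁ : Tendsto g₁ (𝓝[≠] a) (𝓝 g₁'))
    (hg₀ : Tendsto g₀ (𝓝[≠] a) (𝓝 g₀')) (hh₁ : Tendsto h₁ (𝓝[≠] a) (𝓝 h₁'))
    (hh₀ : Tendsto h₀ (𝓝[≠] a) (𝓝 h₀')) :
    Tendsto (fun x => fuchsMatrix
        (numerator (f₂ x) (f₁ x) (f₀ x) (g₁ x) (g₀ x) (h₁ x) (h₀ x)) x l) (𝓝[≠] a)
      (𝓝 (fuchsMatrix (numerator f₂' f₁' f₀' g₁' g₀' h₁' h₀') a l)) := by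
  have hx := tendsto_id_nhdsNE a
  have hn := ((hf₂.mul_const (l ^ 2)).add (hf₁.mul_const l)).add hf₀
  refine Tendsto.smul (((hx.const_sub l).const_mul (l * (l - 1))).inv₀ (cubic_ne_zero h0 h1 ha)) ?_
  refine tendsto_pi_nhds.2 fun i => tendsto_pi_nhds.2 fun j => ?_
  fin_cases i <;> fin_cases j
  · simpa [numerator] using hn
  · simpa [numerator] using (hg₁.mul_const l).add hg₀
  · simpa [numerator] using (hh₁.mul_const l).add hh₀
  · exact hn.neg

/-- Convergence of a system whose upper right entry `G (1 - η l)` becomes constant and whose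
diagonal entry is controlled, through `B + η C`, at the zero `1 / η` of that entry. -/
theorem tendsto_of_tendsto_const_entry {a α₁ α₂ α₃ e b G₀ : ℂ} (ha₀ : a ≠ 0) (ha₁ : a ≠ 1)
    (he : e ≠ 0) (hG₀ : G₀ ≠ 0) {B C G η H₁ H₀ : ℂ → ℂ}
    (hrel : ∀ᶠ x in 𝓝[≠] a, C x ^ 2 + G x * H₀ x = α₁ ^ 2 * x ^ 2 ∧
      (-e * x ^ 2 + B x * x + C x) ^ 2 + (-(G x * η x) * x + G x) * (H₁ x * x + H₀ x)
        = α₂ ^ 2 * (x * (x - 1)) ^ 2 ∧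
      (-e + B x + C x) ^ 2 + (-(G x * η x) + G x) * (H₁ x + H₀ x) = α₃ ^ 2 * (1 - x) ^ 2)
    (hη : Tendsto η (𝓝[≠] a) (𝓝 0)) (hG : Tendsto G (𝓝[≠] a) (𝓝 G₀))
    (hB : Tendsto (fun x => B x + η x * C x) (𝓝[≠] a) (𝓝 b)) :
    ∃ c h₁ h₀ : ℂ,
      c = 1 / (2 * e) * (b ^ 2 - 2 * e * b * (1 + a) + e ^ 2 * (a ^ 2 + a + 1)
        - α₁ ^ 2 * a - α₃ ^ 2 * (1 - a) - α₂ ^ 2 * a * (a - 1)) ∧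
      Tendsto B (𝓝[≠] a) (𝓝 b) ∧ Tendsto C (𝓝[≠] a) (𝓝 c) ∧
      Tendsto H₁ (𝓝[≠] a) (𝓝 h₁) ∧ Tendsto H₀ (𝓝[≠] a) (𝓝 h₀) ∧
      c ^ 2 + G₀ * h₀ = α₁ ^ 2 * a ^ 2 ∧
      (-e * a ^ 2 + b * a + c) ^ 2 + G₀ * (h₁ * a + h₀) = α₂ ^ 2 * (a * (a - 1)) ^ 2 ∧
      (-e + b + c) ^ 2 + G₀ * (h₁ + h₀) = α₃ ^ 2 * (1 - a) ^ 2 := by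
  have hx := tendsto_id_nhdsNE a
  have ha₁' : a - 1 ≠ 0 := sub_ne_zero.2 ha₁
  have ha₁'' : 1 - a ≠ 0 := sub_ne_zero.2 ha₁.symm
  have n1 : ∀ᶠ x in 𝓝[≠] a, 1 - η x ≠ 0 :=
    (hη.const_sub 1).eventually_ne (by simp)
  have nx : ∀ᶠ x in 𝓝[≠] a, 1 - η x * x ≠ 0 :=
    ((hη.mul hx).const_sub 1).eventually_ne (by simp)
  have nG : ∀ᶠ x in 𝓝[≠] a, G x ≠ 0 := hG.eventually_ne hG₀
  set c : ℂ := 1 / (2 * e) * (b ^ 2 - 2 * e * b * (1 + a) + e ^ 2 * (a ^ 2 + a + 1)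
        - α₁ ^ 2 * a - α₃ ^ 2 * (1 - a) - α₂ ^ 2 * a * (a - 1)) with hc
  -- Write the diagonal entry as `φ + C (1 - η l)` with `φ = -e l² + (B + η C) l`. After division by
  -- `1 - η l` each relation equates `(φ² - θ)/(1 - η l)`, where `θ` is the right-hand side, with
  -- `-2 C φ` plus a linear function of `l`. The second divided difference over `0, 1, x` kills the
  -- linear function and leaves `2 e C`, expressed through `x`, `η` and `B + η C`.
  have hC : Tendsto C (𝓝[≠] a) (𝓝 c) := by
    have hcont : ContinuousAt (fun p : ℂ × ℂ × ℂ => 1 / (2 * e) *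
        (((-e + p.2.2) ^ 2 - α₃ ^ 2 * (1 - p.1) ^ 2) / ((1 - p.2.1) * (1 - p.1))
        + ((-e * p.1 ^ 2 + p.2.2 * p.1) ^ 2 - α₂ ^ 2 * (p.1 * (p.1 - 1)) ^ 2)
          / ((1 - p.2.1 * p.1) * (p.1 * (p.1 - 1)))
        - α₁ ^ 2 * p.1)) (a, 0, b) := by
      refine ContinuousAt.mul continuousAt_const (ContinuousAt.sub (ContinuousAt.add
        (ContinuousAt.div (by fun_prop) (by fun_prop) ?_)
        (ContinuousAt.div (by fun_prop) (by fun_prop) ?_)) (by fun_prop))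
      · simpa using ha₁''
      · simpa using ⟨ha₀, ha₁'⟩
    have ht := hcont.tendsto.comp (hx.prodMk_nhds (hη.prodMk_nhds hB))
    refine (ht.congr' ?_).trans (le_of_eq ?_)
    · filter_upwards [hrel, n1, nx, eventually_ne_nhdsNE a 0, eventually_ne_nhdsNE a 1]
        with x ⟨r0, rx, r1⟩ n1 nx x0 x1
      have x1' : x - 1 ≠ 0 := sub_ne_zero.2 x1
      have x1'' : 1 - x ≠ 0 := sub_ne_zero.2 x1.symm
      have q1 : ((-e + (B x + η x * C x)) ^ 2 - α₃ ^ 2 * (1 - x) ^ 2) / ((1 - η x) * (1 - x))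
          = -(2 * C x * (-e + (B x + η x * C x)) + C x ^ 2 * (1 - η x) + G x * (H₁ x + H₀ x))
            / (1 - x) := by
        rw [div_eq_div_iff (mul_ne_zero n1 x1'') x1'']
        linear_combination (1 - x) * r1
      have qx : ((-e * x ^ 2 + (B x + η x * C x) * x) ^ 2 - α₂ ^ 2 * (x * (x - 1)) ^ 2)
            / ((1 - η x * x) * (x * (x - 1)))
          = -(2 * C x * (-e * x ^ 2 + (B x + η x * C x) * x) + C x ^ 2 * (1 - η x * x)
            + G x * (H₁ x * x + H₀ x)) / (x * (x - 1)) := by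
        rw [div_eq_div_iff (mul_ne_zero nx (mul_ne_zero x0 x1')) (mul_ne_zero x0 x1')]
        linear_combination (x * (x - 1)) * rx
      have q0 : α₁ ^ 2 * x = (C x ^ 2 + G x * H₀ x) / x := by
        rw [r0]; field_simp
      simp only [Function.comp]
      rw [q1, qx, q0, show 1 - x = -(x - 1) by ring]
      field_simp
      ring
    · congr 1
      simp only [hc]
      have x1e : 1 - a = -(a - 1) := by ring
      rw [x1e]
      field_simp
      ring
  have hB' : Tendsto B (𝓝[≠] a) (𝓝 b) := by
    have := hB.sub (hη.mul hC)
    simpa using this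
  have hH0 : Tendsto H₀ (𝓝[≠] a) (𝓝 ((α₁ ^ 2 * a ^ 2 - c ^ 2) / G₀)) := by
    refine ((((hx.pow 2).const_mul (α₁ ^ 2)).sub (hC.pow 2)).div hG hG₀).congr' ?_
    filter_upwards [hrel, nG] with x ⟨r0, _, _⟩ nG
    simp only [Pi.div_apply]
    field_simp
    linear_combination -r0
  have hH10 : Tendsto (fun x => H₁ x + H₀ x) (𝓝[≠] a)
      (𝓝 ((α₃ ^ 2 * (1 - a) ^ 2 - (-e + b + c) ^ 2) / (G₀ * (1 - 0)))) := by
    refine (((((hx.const_sub 1).pow 2).const_mul (α₃ ^ 2)).sub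
      (((hB'.const_add (-e)).add hC).pow 2)).div (hG.mul (hη.const_sub 1))
        (by simpa using hG₀)).congr' ?_
    filter_upwards [hrel, nG, n1] with x ⟨_, _, r1⟩ nG n1
    simp only [Pi.div_apply]
    field_simp
    linear_combination -r1
  have hH1 : Tendsto H₁ (𝓝[≠] a) (𝓝 ((α₃ ^ 2 * (1 - a) ^ 2 - (-e + b + c) ^ 2) / (G₀ * (1 - 0))
      - (α₁ ^ 2 * a ^ 2 - c ^ 2) / G₀)) := by
    simpa using hH10.sub hH0
  refine ⟨c, _, _, rfl, hB', hC, hH1, hH0, ?_, ?_, ?_⟩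
  · field_simp
    ring
  · simp only [sub_zero, mul_one]
    rw [show c = 1 / (2 * e) * (b ^ 2 - 2 * e * b * (1 + a) + e ^ 2 * (a ^ 2 + a + 1)
        - α₁ ^ 2 * a - α₃ ^ 2 * (1 - a) - α₂ ^ 2 * a * (a - 1)) from hc]
    field_simp
    ring
  · simp only [sub_zero, mul_one]
    field_simp
    ring

/-! ### Gauge transformations -/

theorem gaugeTransform_eq {R A : ℂ → Mat2} {l : ℂ} {R' S : Mat2}
    (hR : ∀ i j, HasDerivAt (fun t => R t i j) (R' i j) l) (hS : R l * S = 1) :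
    gaugeTransform R A l = R l * A l * S + R' * S := by
  rw [gaugeTransform, Matrix.inv_eq_right_inv hS]
  congr 2
  ext i j
  exact (hR i j).deriv

/-- The new upper right numerator is `2k(l+r)f + (l+r)²g - k²h + k l(l-1)(l-x)`, where `f, g, h` are
the old entries. The condition `hg` kills its coefficient of `l³` and `hr` that of `l²`; this is
what fixes `k` and `r`. -/
theorem gaugeTransform_upper {r k x l : ℂ} (hk : k ≠ 0) (h0 : l ≠ 0) (h1 : l ≠ 1) (hx : l ≠ x)
    (f₂ f₁ f₀ g₁ g₀ h₁ h₀ : ℂ) (hg : g₁ = (-2 * f₂ - 1) * k)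
    (hr : 2 * k * (f₁ + f₂ * r) + g₀ + 2 * g₁ * r = k * (1 + x)) :
    gaugeTransform (fun t => !![t + r, -k; k⁻¹, 0])
      (fuchsMatrix (numerator f₂ f₁ f₀ g₁ g₀ h₁ h₀) x) l =
    fuchsMatrix (numerator (1 + f₂) (-(g₀ + r * g₁) / k - f₁) (-(r * g₀) / k - f₀)
      (2 * k * (f₀ + r * f₁) + 2 * r * g₀ + r ^ 2 * g₁ - k ^ 2 * h₁ + k * x)
      (2 * k * r * f₀ + r ^ 2 * g₀ - k ^ 2 * h₀) (-g₁ / k ^ 2) (-g₀ / k ^ 2)) x l := by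
  have h1' := sub_ne_zero.2 h1
  have hx' := sub_ne_zero.2 hx
  have hR : ∀ i j, HasDerivAt (fun t => !![t + r, -k; k⁻¹, 0] i j)
      ((!![1, 0; 0, 0] : Mat2) i j) l := by
    intro i j
    fin_cases i <;> fin_cases j
    · exact (hasDerivAt_id' l).add_const r
    all_goals exact hasDerivAt_const _ _
  have hS : (!![l + r, -k; k⁻¹, 0] : Mat2) * !![0, k; -k⁻¹, l + r] = 1 := by
    ext i j
    fin_cases i <;> fin_cases j <;> simp [hk] 
    ring
  rw [gaugeTransform_eq hR hS]
  have hg₀ : g₀ = k * (1 + x) - 2 * k * (f₁ + f₂ * r) - 2 * g₁ * r := by linear_combination hr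
  ext i j
  fin_cases i <;> fin_cases j <;>
    simp [fuchsMatrix, numerator] <;> field_simp <;>
    subst hg₀ <;> subst hg <;> ring

/-- Mirror image of `gaugeTransform_upper`: here `hh` and `hr` remove the cubic and quadratic terms
of the lower left numerator. -/
theorem gaugeTransform_lower {r k x l : ℂ} (hk : k ≠ 0) (h0 : l ≠ 0) (h1 : l ≠ 1) (hx : l ≠ x)
    (f₂ f₁ f₀ g₁ g₀ h₁ h₀ : ℂ) (hh : h₁ = (1 - 2 * f₂) * k)
    (hr : 2 * k * (f₁ + f₂ * r) + h₀ + 2 * h₁ * r = -(k * (1 + x))) :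
    gaugeTransform (fun t => !![0, -k⁻¹; k, t + r])
      (fuchsMatrix (numerator f₂ f₁ f₀ g₁ g₀ h₁ h₀) x) l =
    fuchsMatrix (numerator (f₂ - 1) (-(h₀ + r * h₁) / k - f₁) (-(r * h₀) / k - f₀)
      (-h₁ / k ^ 2) (-h₀ / k ^ 2)
      (2 * k * (f₀ + r * f₁) + 2 * r * h₀ + r ^ 2 * h₁ - k ^ 2 * g₁ - k * x)
      (2 * k * r * f₀ + r ^ 2 * h₀ - k ^ 2 * g₀)) x l := by
  have h1' := sub_ne_zero.2 h1
  have hx' := sub_ne_zero.2 hx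
  have hR : ∀ i j, HasDerivAt (fun t => !![0, -k⁻¹; k, t + r] i j)
      ((!![0, 0; 0, 1] : Mat2) i j) l := by
    intro i j
    fin_cases i <;> fin_cases j
    all_goals first | exact hasDerivAt_const _ _ | exact (hasDerivAt_id' l).add_const r
  have hS : (!![0, -k⁻¹; k, l + r] : Mat2) * !![l + r, k⁻¹; -k, 0] = 1 := by
    ext i j
    fin_cases i <;> fin_cases j <;> simp [hk]
    ring
  rw [gaugeTransform_eq hR hS]
  have hh₀ : h₀ = -(k * (1 + x)) - 2 * k * (f₁ + f₂ * r) - 2 * h₁ * r := by linear_combination hr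
  ext i j
  fin_cases i <;> fin_cases j <;>
    simp [fuchsMatrix, numerator] <;> field_simp <;>
    subst hh₀ <;> subst hh <;> ring

theorem IsSqrtBranch.hasDerivAt {s : ℂ → ℂ} {U : Set ℂ} (hs : IsSqrtBranch s U) (hU : IsOpen U)
    {l : ℂ} (hl : l ∈ U) (h0 : l ≠ 0) : HasDerivAt s (1 / (2 * s l)) l := by
  have hd := (hs.1.differentiableAt (hU.mem_nhds hl)).hasDerivAt
  have h2 : HasDerivAt (fun t => s t ^ 2) 1 l :=
    (hasDerivAt_id l).congr_of_eventuallyEq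
      (by filter_upwards [hU.mem_nhds hl] with t ht using hs.2 t ht)
  have h3 := (hd.fun_pow 2).unique h2
  have h5 : s l ≠ 0 := fun h => h0 (by rw [← hs.2 l hl, h]; ring)
  rwa [show 1 / (2 * s l) = deriv s l by
    field_simp; norm_num at h3; linear_combination -h3]

/-- The two factors `1/√l` could create a double pole at `0`. By `hf₀` and `hh₀` the row `(g, -k)`
is a left eigenvector of the numerator at `0` with eigenvalue `w`, and it annihilates the column
`(1, g/k)` of the inverse, so the pole stays simple. -/
theorem gaugeTransform_sqrt {s : ℂ → ℂ} {U : Set ℂ} (hs : IsSqrtBranch s U) (hU : IsOpen U)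
    {g k y w x l : ℂ} (hl : l ∈ U) (hk : k ≠ 0) (h0 : l ≠ 0) (h1 : l ≠ 1) (hx : l ≠ x)
    (f₁ f₀ h₁ h₀ : ℂ) (hf₀ : f₀ = g * y - w) (hh₀ : h₀ = -((2 * w - g * y) * g / k)) :
    gaugeTransform (fun t => (s t)⁻¹ • !![t + g, -k; -(g / k), 1])
      (fuchsMatrix (numerator (-1) f₁ f₀ k (-(k * y)) h₁ h₀) x) l =
    fuchsMatrix (numerator (-(1 / 2)) (f₁ - g - (1 + x) / 2)
      (-(k * h₁ - 2 * g * f₁ - g ^ 2) - w + x / 2)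
      (k * (2 * f₁ - y - 1 - x)) (k * (-(k * h₁ - 2 * g * f₁ - g ^ 2) + x - 2 * w))
      (2 * g / k) ((k * h₁ - 2 * g * f₁ - g ^ 2) / k)) x l := by
  have hsd := hs.hasDerivAt hU hl h0
  have hs2 := hs.2 l hl
  have hs0 : s l ≠ 0 := fun h => h0 (by rw [← hs2, h]; ring)
  have hsi : HasDerivAt (fun t => (s t)⁻¹) (-(1 / (2 * s l ^ 3))) l :=
    (hsd.fun_inv hs0).congr_deriv (by field_simp)
  have hR : ∀ i j, HasDerivAt (fun t => ((s t)⁻¹ • (!![t + g, -k; -(g / k), 1] : Mat2)) i j)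
      ((!![-(1 / (2 * s l ^ 3)) * (l + g) + (s l)⁻¹ * 1, -(1 / (2 * s l ^ 3)) * -k;
        -(1 / (2 * s l ^ 3)) * -(g / k), -(1 / (2 * s l ^ 3)) * 1] : Mat2) i j) l := by
    intro i j
    fin_cases i <;> fin_cases j
    · exact hsi.fun_mul ((hasDerivAt_id' l).add_const g)
    all_goals exact hsi.mul_const _
  have hS : ((s l)⁻¹ • (!![l + g, -k; -(g / k), 1] : Mat2)) *
      ((s l)⁻¹ • !![1, k; g / k, l + g]) = 1 := by
    clear hsd hsi hR
    generalize s l = σ at *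
    subst hs2
    ext i j
    fin_cases i <;> fin_cases j <;> simp <;> field_simp <;> ring
  rw [gaugeTransform_eq hR hS]
  have h1' := sub_ne_zero.2 h1
  have hx' := sub_ne_zero.2 hx
  clear hsd hsi hR hS
  generalize s l = σ at *
  subst hs2 hf₀ hh₀
  ext i j
  fin_cases i <;> fin_cases j <;>
    simp [fuchsMatrix, numerator] <;> field_simp <;> ring

/-! ### Logarithmic derivatives near a puncture -/

/-- The punctured disc is the image of a half-plane under the exponential map. -/
theorem isPreconnected_ball_diff_singleton (a : ℂ) {r : ℝ} (hr : 0 < r) :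
    IsPreconnected (Metric.ball a r \ {a}) := by
  have h : Metric.ball a r \ {a} = (fun w => a + Complex.exp w) '' {w | w.re < Real.log r} := by
    ext z
    simp only [Set.mem_sdiff, Metric.mem_ball, Set.mem_singleton_iff, Set.mem_image,
      Set.mem_ofPred_eq, dist_eq_norm]
    constructor
    · rintro ⟨h1, h2⟩
      have h3 : z - a ≠ 0 := sub_ne_zero.2 h2
      refine ⟨Complex.log (z - a), ?_, by rw [Complex.exp_log h3]; ring⟩
      rw [Complex.log_re]
      exact Real.log_lt_log (norm_pos_iff.2 h3) h1
    · rintro ⟨w, hw, rfl⟩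
      rw [add_sub_cancel_left, Complex.norm_exp]
      exact ⟨(Real.lt_log_iff_exp_lt hr).1 hw, by simp⟩
  rw [h]
  exact (convex_halfSpace_re_lt _).isPreconnected.image _ (by fun_prop)

/-- With a primitive `g` of `φ` on a disc, `K exp(-g)` has zero derivative on the connected
punctured disc, hence is a nonzero constant there. -/
theorem exists_tendsto_ne_zero_of_logDeriv {a : ℂ} {K φ : ℂ → ℂ} {s : Set ℂ} (hs : s ∈ 𝓝 a)
    (hφ : DifferentiableOn ℂ φ s)
    (hK : ∀ᶠ x in 𝓝[≠] a, K x ≠ 0 ∧ HasDerivAt K (φ x * K x) x) :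
    ∃ κ₀ : ℂ, κ₀ ≠ 0 ∧ Tendsto K (𝓝[≠] a) (𝓝 κ₀) := by
  obtain ⟨r, hr, hr'⟩ := Metric.eventually_nhds_iff_ball.1
    ((eventually_nhdsWithin_iff.1 hK).and hs)
  obtain ⟨g, hg⟩ := (hφ.mono fun x hx => (hr' x hx).2 : DifferentiableOn ℂ φ
    (Metric.ball a r)).isExactOn_ball
  set V := Metric.ball a r \ {a} with hV
  have hVo : IsOpen V := Metric.isOpen_ball.sdiff isClosed_singleton
  have hVa : V ∈ 𝓝[≠] a := by
    rw [hV, Set.sdiff_eq, Set.inter_comm]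
    exact inter_mem self_mem_nhdsWithin (mem_nhdsWithin_of_mem_nhds (Metric.ball_mem_nhds a hr))
  have hd : ∀ x ∈ V, HasDerivAt (fun x => K x * Complex.exp (-g x)) 0 x := fun x hx =>
    (((hr' x hx.1).1 hx.2).2.fun_mul (hg x hx.1).fun_neg.cexp).congr_deriv (by ring)
  obtain ⟨c, hc⟩ := hVo.exists_is_const_of_deriv_eq_zero
    (isPreconnected_ball_diff_singleton a hr)
    (fun x hx => (hd x hx).differentiableAt.differentiableWithinAt) (fun x hx => (hd x hx).deriv)
  have hc0 : c ≠ 0 := by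
    obtain ⟨x, hx⟩ := (𝓝[≠] a).nonempty_of_mem hVa
    rw [← hc x hx]
    exact mul_ne_zero ((hr' x hx.1).1 hx.2).1 (Complex.exp_ne_zero _)
  refine ⟨c * Complex.exp (g a), mul_ne_zero hc0 (Complex.exp_ne_zero _), ?_⟩
  have hga : Tendsto g (𝓝[≠] a) (𝓝 (g a)) :=
    (hg a (Metric.mem_ball_self hr)).continuousAt.tendsto.mono_left nhdsWithin_le_nhds
  refine (hga.cexp.const_mul c).congr' ?_
  filter_upwards [hVa] with x hx
  rw [← hc x hx, mul_assoc, ← Complex.exp_add, neg_add_cancel, Complex.exp_zero, mul_one]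

/-! ### The leading behaviour at a pole -/

theorem exists_eventuallyEq_div_pow {y : ℂ → ℂ} {a : ℂ} (hy : MeromorphicAt y a)
    (hpole : meromorphicOrderAt y a < 0) :
    ∃ (n : ℕ) (f : ℂ → ℂ), 1 ≤ n ∧ meromorphicOrderAt y a = ((-(n : ℤ) : ℤ) : WithTop ℤ) ∧
      AnalyticAt ℂ f a ∧ f a ≠ 0 ∧ ∀ᶠ x in 𝓝[≠] a, y x = f x / (x - a) ^ n := by
  obtain ⟨m, hm⟩ := WithTop.ne_top_iff_exists.1 (ne_top_of_lt hpole)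
  have hm0 : m < 0 := by rw [← hm] at hpole; exact_mod_cast hpole
  obtain ⟨f, hf, hfa, hfy⟩ := (meromorphicOrderAt_eq_int_iff hy).1 hm.symm
  obtain ⟨k, rfl⟩ : ∃ k : ℕ, m = -(k : ℤ) := ⟨m.natAbs, by omega⟩
  refine ⟨k, f, by omega, hm.symm, hf, hfa, ?_⟩
  filter_upwards [hfy] with x hx
  rw [hx, zpow_neg, zpow_natCast, smul_eq_mul, mul_comm, div_eq_mul_inv]

theorem eventually_hasDerivAt_of_eq_div_pow {y f : ℂ → ℂ} {a : ℂ} {n : ℕ} (hf : AnalyticAt ℂ f a)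
    (h : ∀ᶠ x in 𝓝[≠] a, y x = f x / (x - a) ^ n) :
    ∀ᶠ x in 𝓝[≠] a, deriv y x = ((x - a) * deriv f x - n * f x) / (x - a) ^ (n + 1) := by
  have hf' := hf.eventually_analyticAt.filter_mono (nhdsWithin_le_nhds (s := {a}ᶜ))
  filter_upwards [eventually_eventually_nhdsWithin.2 h, hf', eventually_ne_nhdsNE a a]
    with x hx hfx hxa
  rw [isOpen_compl_singleton.nhdsWithin_eq hxa] at hx
  have hxa' : x - a ≠ 0 := sub_ne_zero.2 hxa
  have hd := hfx.differentiableAt.hasDerivAt.fun_div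
    (((hasDerivAt_id' x).sub_const a).fun_pow n) (pow_ne_zero n hxa')
  rw [EventuallyEq.deriv_eq hx, hd.deriv]
  rcases n with _ | n
  · simp; field_simp
  · field_simp
    push_cast
    ring

/-- The sixth Painlevé equation for `y = F / s`, `y' = F₁ / (s t)`, `y'' = F₂ / (s t²)`. -/
theorem painleveVI_scaled {δ α₁ α₂ α₃ x F F₁ F₂ s t : ℂ} {y : ℂ → ℂ}
    (h : PainleveVI δ α₁ α₂ α₃ y x) (hy : y x = F / s) (hy' : deriv y x = F₁ / (s * t))
    (hy'' : deriv (deriv y) x = F₂ / (s * t ^ 2)) (hs : s ≠ 0) (ht : t ≠ 0) :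
    s ^ 2 * (F₂ - 1 / 2 * (F⁻¹ + (F - s)⁻¹ + (F - x * s)⁻¹) * F₁ ^ 2
      + t * (x⁻¹ + (x - 1)⁻¹ + s * (F - x * s)⁻¹) * F₁) =
    t ^ 2 * (F * (F - s) * (F - x * s) * (x ^ 2 * (x - 1) ^ 2)⁻¹ *
      (2 * (δ - 1 / 2) ^ 2 + s ^ 2 * (- 2 * α₁ ^ 2 * x * F⁻¹ ^ 2
        + 2 * α₃ ^ 2 * (x - 1) * (F - s)⁻¹ ^ 2
        - 2 * (α₂ ^ 2 - 1 / 4) * x * (x - 1) * (F - x * s)⁻¹ ^ 2))) := by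
  unfold PainleveVI at h
  have e1 : y x - 1 = (F - s) / s := by rw [hy]; field_simp
  have e2 : y x - x = (F - x * s) / s := by rw [hy]; field_simp
  rw [hy'', hy', e1, e2, hy] at h
  simp only [one_div, div_pow, div_div_eq_mul_div] at h
  simp only [div_eq_mul_inv F, div_eq_mul_inv (F - s), div_eq_mul_inv (F - x * s)] at h
  simp only [div_eq_mul_inv _ F, div_eq_mul_inv _ (F - s), div_eq_mul_inv _ (F - x * s),
    div_eq_mul_inv _ (F ^ 2), div_eq_mul_inv _ ((F - s) ^ 2), div_eq_mul_inv _ ((F - x * s) ^ 2),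
    div_eq_mul_inv _ (x ^ 2 * (x - 1) ^ 2), ← inv_pow F, ← inv_pow (F - s),
    ← inv_pow (F - x * s)] at h
  -- The inverses become independent atoms: only `s` and `t` are known to be nonzero, and only they
  -- have to be cancelled.
  generalize (F - s)⁻¹ = A at *
  generalize (F - x * s)⁻¹ = B at *
  generalize F⁻¹ = C at *
  generalize (x ^ 2 * (x - 1) ^ 2)⁻¹ = E at *
  generalize x⁻¹ = X at *
  generalize (x - 1)⁻¹ = X' at *
  field_simp at h
  linear_combination h / 8

/-- The order of a pole of a solution of the sixth Painlevé equation, and the leading coefficient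
of a simple pole. -/
theorem painleveVI_pole {δ α₁ α₂ α₃ a : ℂ} (ha₀ : a ≠ 0) (ha₁ : a ≠ 1) {y f : ℂ → ℂ} {n : ℕ}
    (hn : 1 ≤ n) (hf : AnalyticAt ℂ f a) (hfa : f a ≠ 0)
    (hfy : ∀ᶠ x in 𝓝[≠] a, y x = f x / (x - a) ^ n)
    (hPVI : ∀ᶠ x in 𝓝[≠] a, PainleveVI δ α₁ α₂ α₃ y x) :
    (δ ≠ 1 / 2 → n = 1 ∧ (2 * (δ - 1 / 2) * f a) ^ 2 = (a * (a - 1)) ^ 2) ∧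
    (δ = 1 / 2 → n = 2) := by
  obtain ⟨m, rfl⟩ : ∃ m, n = m + 1 := ⟨n - 1, by omega⟩
  have ha₁' : a - 1 ≠ 0 := sub_ne_zero.2 ha₁
  set f₁ : ℂ → ℂ := fun x => (x - a) * deriv f x - ((m + 1 : ℕ) : ℂ) * f x with hf₁def
  have hf₁ : AnalyticAt ℂ f₁ a := by
    have := hf.deriv
    fun_prop
  set f₂ : ℂ → ℂ := fun x => (x - a) * deriv f₁ x - ((m + 1 + 1 : ℕ) : ℂ) * f₁ x with hf₂def
  have hf₂ : AnalyticAt ℂ f₂ a := by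
    have := hf₁.deriv
    fun_prop
  have hy' := eventually_hasDerivAt_of_eq_div_pow hf hfy
  have hy'' := eventually_hasDerivAt_of_eq_div_pow (y := deriv y) hf₁ hy'
  set L : ℂ → ℂ := fun x => f₂ x - 1 / 2 * ((f x)⁻¹ + (f x - (x - a) ^ (m + 1))⁻¹
    + (f x - x * (x - a) ^ (m + 1))⁻¹) * f₁ x ^ 2 + (x - a) * (x⁻¹ + (x - 1)⁻¹
    + (x - a) ^ (m + 1) * (f x - x * (x - a) ^ (m + 1))⁻¹) * f₁ x with hL
  set P : ℂ → ℂ := fun x => f x * (f x - (x - a) ^ (m + 1)) * (f x - x * (x - a) ^ (m + 1))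
    * (x ^ 2 * (x - 1) ^ 2)⁻¹ with hP
  set Q : ℂ → ℂ := fun x => - 2 * α₁ ^ 2 * x * (f x)⁻¹ ^ 2
    + 2 * α₃ ^ 2 * (x - 1) * (f x - (x - a) ^ (m + 1))⁻¹ ^ 2
    - 2 * (α₂ ^ 2 - 1 / 4) * x * (x - 1) * (f x - x * (x - a) ^ (m + 1))⁻¹ ^ 2 with hQ
  -- The Painlevé equation cleared of the pole, with `n = m + 1`. Since `L`, `P`, `Q` are continuous
  -- at `a`, the powers of `x - a` show which terms dominate.
  have hmain : ∀ᶠ x in 𝓝[≠] a, ((x - a) ^ m) ^ 2 * L x =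
      P x * (2 * (δ - 1 / 2) ^ 2 + ((x - a) ^ (m + 1)) ^ 2 * Q x) := by
    filter_upwards [hPVI, hfy, hy', hy'', eventually_ne_nhdsNE a a] with x h h1 h2 h3 hxa
    have ht : x - a ≠ 0 := sub_ne_zero.2 hxa
    have := painleveVI_scaled h h1 (F₁ := f₁ x) (t := x - a) (by rw [h2, pow_succ _ (m + 1)])
      (F₂ := f₂ x) (by rw [h3]; congr 1; ring) (pow_ne_zero _ ht) ht
    refine mul_left_cancel₀ (pow_ne_zero 2 ht) ?_
    simp only [hL, hP, hQ]
    linear_combination this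
  have cf := hf.continuousAt
  have cf₁ := hf₁.continuousAt
  have cf₂ := hf₂.continuousAt
  have hs : (a - a) ^ (m + 1) = 0 := by simp
  have c1 : ContinuousAt (fun x => (f x - (x - a) ^ (m + 1))⁻¹) a :=
    ContinuousAt.inv₀ (by fun_prop) (by simpa using hfa)
  have c2 : ContinuousAt (fun x => (f x - x * (x - a) ^ (m + 1))⁻¹) a :=
    ContinuousAt.inv₀ (by fun_prop) (by simpa using hfa)
  have c0 : ContinuousAt (fun x => (f x)⁻¹) a := cf.inv₀ hfa
  have cx : ContinuousAt (fun x : ℂ => x⁻¹) a := continuousAt_id.inv₀ ha₀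
  have cx1 : ContinuousAt (fun x : ℂ => (x - 1)⁻¹) a :=
    ContinuousAt.inv₀ (by fun_prop) ha₁'
  have cxx : ContinuousAt (fun x : ℂ => (x ^ 2 * (x - 1) ^ 2)⁻¹) a :=
    ContinuousAt.inv₀ (by fun_prop) (mul_ne_zero (pow_ne_zero 2 ha₀) (pow_ne_zero 2 ha₁'))
  have cL : ContinuousAt L a := by fun_prop
  have cP : ContinuousAt P a := by fun_prop
  have cQ : ContinuousAt Q a := by fun_prop
  have f1a : f₁ a = -(m + 1) * f a := by simp [hf₁def]; ring
  have f2a : f₂ a = (m + 2) * (m + 1) * f a := by simp only [hf₂def, f1a]; push_cast; ring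
  -- This is `n(n+1) - (3/2)n²` times `f a`, with `n = m + 1`. For `δ ≠ 1/2` the right side of
  -- `hmain` has a nonzero limit, which forces `m = 0`; the limit then gives the square of the
  -- leading coefficient.
  have La : L a = (m + 1) * (1 - m) / 2 * f a := by
    simp only [hL, f1a, f2a, hs, mul_zero, sub_zero]
    simp only [sub_self, zero_mul, add_zero]
    field_simp
    ring
  have Pa : P a = f a ^ 3 / (a ^ 2 * (a - 1) ^ 2) := by
    simp only [hP, hs, mul_zero, sub_zero]
    field_simp
  refine ⟨fun hδ => ?_, fun hδ => ?_⟩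
  · have hlim : ((a - a) ^ m) ^ 2 * L a =
        P a * (2 * (δ - 1 / 2) ^ 2 + ((a - a) ^ (m + 1)) ^ 2 * Q a) := by
      have t1 : Tendsto (fun x => ((x - a) ^ m) ^ 2 * L x) (𝓝[≠] a) _ :=
        (ContinuousAt.tendsto (by fun_prop :
          ContinuousAt (fun x => ((x - a) ^ m) ^ 2 * L x) a)).mono_left nhdsWithin_le_nhds
      have t2 : Tendsto (fun x => P x * (2 * (δ - 1 / 2) ^ 2 + ((x - a) ^ (m + 1)) ^ 2 * Q x))
          (𝓝[≠] a) _ :=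
        (ContinuousAt.tendsto (by fun_prop : ContinuousAt (fun x => P x *
          (2 * (δ - 1 / 2) ^ 2 + ((x - a) ^ (m + 1)) ^ 2 * Q x)) a)).mono_left nhdsWithin_le_nhds
      exact tendsto_nhds_unique (t1.congr' hmain) t2
    rw [hs, La, Pa] at hlim
    have hδ' : δ - 1 / 2 ≠ 0 := sub_ne_zero.2 hδ
    rcases m with _ | m
    · refine ⟨rfl, ?_⟩
      simp only [pow_zero, Nat.cast_zero] at hlim
      field_simp at hlim
      refine mul_left_cancel₀ hfa ?_
      linear_combination -(f a) * hlim
    · exfalso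
      simp only [sub_self, ne_eq, Nat.add_eq_zero_iff, one_ne_zero, and_false,
        not_false_eq_true, zero_pow, zero_mul, OfNat.ofNat_ne_zero] at hlim
      refine (mul_ne_zero (div_ne_zero (pow_ne_zero 3 hfa)
        (mul_ne_zero (pow_ne_zero 2 ha₀) (pow_ne_zero 2 ha₁')))
        (mul_ne_zero two_ne_zero (pow_ne_zero 2 hδ'))) ?_
      simpa using hlim.symm
  · subst hδ
    -- For `δ = 1/2` the factor `(x - a)^(2m)` is common to both sides and is cancelled before the
    -- limit is taken. What remains is `L a = 0`, that is `m = 1`.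
    have hlim : L a = P a * ((a - a) ^ 2 * Q a) := by
      have t1 := cL.tendsto.mono_left (nhdsWithin_le_nhds (s := {a}ᶜ))
      have t2 : Tendsto (fun x => P x * ((x - a) ^ 2 * Q x)) (𝓝[≠] a) _ :=
        (ContinuousAt.tendsto (by fun_prop : ContinuousAt (fun x => P x *
          ((x - a) ^ 2 * Q x)) a)).mono_left nhdsWithin_le_nhds
      refine tendsto_nhds_unique (t1.congr' ?_) t2
      filter_upwards [hmain, eventually_ne_nhdsNE a a] with x hx hxa
      refine mul_left_cancel₀ (pow_ne_zero 2 (pow_ne_zero m (sub_ne_zero.2 hxa))) ?_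
      rw [hx]; ring
    rw [La] at hlim
    have h1 : ((m : ℂ) + 1) * (1 - m) = 0 := by
      have : ((m : ℂ) + 1) * (1 - m) / 2 * f a = 0 := by rw [hlim]; simp
      simpa [hfa] using this
    rcases mul_eq_zero.1 h1 with h | h
    · exact absurd h (Nat.cast_add_one_ne_zero m)
    · have : m = 1 := by
        have h2 : (m : ℂ) = 1 := by linear_combination -h
        exact_mod_cast h2
      omega

/-! ### Preservation of the residue eigenvalues -/

/-- At `l = 0, 1, x` the derivative term of the gauge transformation carries the factor `l(l-1)(l-x)
= 0`, so old and new numerators are conjugate there. -/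
theorem hasResidueEigenvalues_upper {r k x e₁ e₂ e₃ f₂ f₁ f₀ g₁ g₀ h₁ h₀ : ℂ} (hk : k ≠ 0)
    (hx₀ : x ≠ 0) (hx₁ : x ≠ 1) (hg : g₁ = (-2 * f₂ - 1) * k)
    (hr : 2 * k * (f₁ + f₂ * r) + g₀ + 2 * g₁ * r = k * (1 + x))
    (h : HasResidueEigenvalues (numerator f₂ f₁ f₀ g₁ g₀ h₁ h₀) x e₁ e₂ e₃) :
    HasResidueEigenvalues (numerator (1 + f₂) (-(g₀ + r * g₁) / k - f₁) (-(r * g₀) / k - f₀)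
      (2 * k * (f₀ + r * f₁) + 2 * r * g₀ + r ^ 2 * g₁ - k ^ 2 * h₁ + k * x)
      (2 * k * r * f₀ + r ^ 2 * g₀ - k ^ 2 * h₀) (-g₁ / k ^ 2) (-g₀ / k ^ 2)) x e₁ e₂ e₃ := by
  rw [hasResidueEigenvalues_iff hx₀ hx₁] at h ⊢
  obtain ⟨h1, h2, h3⟩ := h
  have hg₀ : g₀ = k * (1 + x) - 2 * k * (f₁ + f₂ * r) - 2 * g₁ * r := by linear_combination hr
  subst hg₀
  subst hg
  refine ⟨?_, ?_, ?_⟩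
  · rw [← h1]; field_simp; ring
  · rw [← h2]; field_simp; ring
  · rw [← h3]; field_simp; ring

theorem hasResidueEigenvalues_lower {r k x e₁ e₂ e₃ f₂ f₁ f₀ g₁ g₀ h₁ h₀ : ℂ} (hk : k ≠ 0)
    (hx₀ : x ≠ 0) (hx₁ : x ≠ 1) (hh : h₁ = (1 - 2 * f₂) * k)
    (hr : 2 * k * (f₁ + f₂ * r) + h₀ + 2 * h₁ * r = -(k * (1 + x)))
    (h : HasResidueEigenvalues (numerator f₂ f₁ f₀ g₁ g₀ h₁ h₀) x e₁ e₂ e₃) :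
    HasResidueEigenvalues (numerator (f₂ - 1) (-(h₀ + r * h₁) / k - f₁) (-(r * h₀) / k - f₀)
      (-h₁ / k ^ 2) (-h₀ / k ^ 2)
      (2 * k * (f₀ + r * f₁) + 2 * r * h₀ + r ^ 2 * h₁ - k ^ 2 * g₁ - k * x)
      (2 * k * r * f₀ + r ^ 2 * h₀ - k ^ 2 * g₀)) x e₁ e₂ e₃ := by
  rw [hasResidueEigenvalues_iff hx₀ hx₁] at h ⊢
  obtain ⟨h1, h2, h3⟩ := h
  have hh₀ : h₀ = -(k * (1 + x)) - 2 * k * (f₁ + f₂ * r) - 2 * h₁ * r := by linear_combination hr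
  subst hh₀
  subst hh
  refine ⟨?_, ?_, ?_⟩
  · rw [← h1]; field_simp; ring
  · rw [← h2]; field_simp; ring
  · rw [← h3]; field_simp; ring

/-! ### The limit systems with a constant off-diagonal entry -/

theorem exists_limit_upper {a α₁ α₂ α₃ e b G₀ : ℂ} (ha₀ : a ≠ 0) (ha₁ : a ≠ 1)
    (he : e ≠ 0) (hG₀ : G₀ ≠ 0) {B C g₁ g₀ h₁ h₀ η : ℂ → ℂ}
    (hres : ∀ᶠ x in 𝓝[≠] a, HasResidueEigenvalues
      (numerator (-e) (B x) (C x) (g₁ x) (g₀ x) (h₁ x) (h₀ x)) x α₁ α₂ α₃)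
    (hg : ∀ᶠ x in 𝓝[≠] a, g₁ x = -(g₀ x * η x))
    (hη : Tendsto η (𝓝[≠] a) (𝓝 0)) (hG : Tendsto g₀ (𝓝[≠] a) (𝓝 G₀))
    (hB : Tendsto (fun x => B x + η x * C x) (𝓝[≠] a) (𝓝 b)) :
    ∃ c h₁' h₀' : ℂ,
      c = 1 / (2 * e) * (b ^ 2 - 2 * e * b * (1 + a) + e ^ 2 * (a ^ 2 + a + 1)
        - α₁ ^ 2 * a - α₃ ^ 2 * (1 - a) - α₂ ^ 2 * a * (a - 1)) ∧
      HasResidueEigenvalues (numerator (-e) b c 0 G₀ h₁' h₀') a α₁ α₂ α₃ ∧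
      (∀ l : ℂ, l ≠ 0 → l ≠ 1 → l ≠ a → Tendsto (fun x => fuchsMatrix
        (numerator (-e) (B x) (C x) (g₁ x) (g₀ x) (h₁ x) (h₀ x)) x l) (𝓝[≠] a)
        (𝓝 (fuchsMatrix (numerator (-e) b c 0 G₀ h₁' h₀') a l))) ∧
      ∀ α β q : ℂ, α + β = 2 - 2 * (α₁ + α₂ + α₃) →
        α * β = (e - (α₁ + α₂ + α₃)) * (2 - e - (α₁ + α₂ + α₃)) →
        q = -(accessoryBase α₁ α₂ α₃ a e + b * (2 * e - 1)) →
        EquivalentToHeun (fuchsMatrix (numerator (-e) b c 0 G₀ h₁' h₀') a) 0 α₁ α₂ α₃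
          a (1 - 2 * α₁) (1 - 2 * α₃) (1 - 2 * α₂) α β q := by
  have hg₁ : Tendsto g₁ (𝓝[≠] a) (𝓝 0) := by
    have := (hG.mul hη).neg
    rw [mul_zero, neg_zero] at this
    exact this.congr' (hg.mono fun x hx => hx.symm)
  obtain ⟨c, h₁', h₀', hc, tB, tC, t1, t0, r0, ra, r1⟩ := tendsto_of_tendsto_const_entry
    (α₁ := α₁) (α₂ := α₂) (α₃ := α₃) ha₀ ha₁ he hG₀ (H₁ := h₁) (H₀ := h₀) (by
      filter_upwards [hres, hg, eventually_ne_nhdsNE a 0, eventually_ne_nhdsNE a 1]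
        with x hx hgx x0 x1
      rwa [hasResidueEigenvalues_iff x0 x1, hgx] at hx) hη hG hB
  refine ⟨c, h₁', h₀', hc, ?_, fun l l0 l1 la => ?_, fun α β q hsum hprod hq => ?_⟩
  · rw [hasResidueEigenvalues_iff ha₀ ha₁]
    simpa only [zero_mul, zero_add] using And.intro r0 (And.intro ra r1)
  · exact tendsto_fuchsMatrix_numerator l0 l1 la tendsto_const_nhds tB tC hg₁ hG t1 t0
  · exact equivalentToHeun_of_const (j := 1) zero_ne_one ha₀ ha₁ hG₀
      (fun l => by simp [numerator]) r0 r1 ra hsum hprod hq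

theorem exists_limit_lower {a α₁ α₂ α₃ e b G₀ : ℂ} (ha₀ : a ≠ 0) (ha₁ : a ≠ 1)
    (he : e ≠ 0) (hG₀ : G₀ ≠ 0) {B C g₁ g₀ h₁ h₀ η : ℂ → ℂ}
    (hres : ∀ᶠ x in 𝓝[≠] a, HasResidueEigenvalues
      (numerator (-e) (B x) (C x) (h₁ x) (h₀ x) (g₁ x) (g₀ x)) x α₁ α₂ α₃)
    (hg : ∀ᶠ x in 𝓝[≠] a, g₁ x = -(g₀ x * η x))
    (hη : Tendsto η (𝓝[≠] a) (𝓝 0)) (hG : Tendsto g₀ (𝓝[≠] a) (𝓝 G₀))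
    (hB : Tendsto (fun x => B x + η x * C x) (𝓝[≠] a) (𝓝 b)) :
    ∃ c h₁' h₀' : ℂ,
      c = 1 / (2 * e) * (b ^ 2 - 2 * e * b * (1 + a) + e ^ 2 * (a ^ 2 + a + 1)
        - α₁ ^ 2 * a - α₃ ^ 2 * (1 - a) - α₂ ^ 2 * a * (a - 1)) ∧
      HasResidueEigenvalues (numerator (-e) b c h₁' h₀' 0 G₀) a α₁ α₂ α₃ ∧
      (∀ l : ℂ, l ≠ 0 → l ≠ 1 → l ≠ a → Tendsto (fun x => fuchsMatrix
        (numerator (-e) (B x) (C x) (h₁ x) (h₀ x) (g₁ x) (g₀ x)) x l) (𝓝[≠] a)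
        (𝓝 (fuchsMatrix (numerator (-e) b c h₁' h₀' 0 G₀) a l))) ∧
      ∀ α β q : ℂ, α + β = 2 - 2 * (α₁ + α₂ + α₃) →
        α * β = (-e - (α₁ + α₂ + α₃)) * (2 + e - (α₁ + α₂ + α₃)) →
        q = -(accessoryBase α₁ α₂ α₃ a e + b * (2 * e + 1)) →
        EquivalentToHeun (fuchsMatrix (numerator (-e) b c h₁' h₀' 0 G₀) a) 1 α₁ α₂ α₃
          a (1 - 2 * α₁) (1 - 2 * α₃) (1 - 2 * α₂) α β q := by
  have hg₁ : Tendsto g₁ (𝓝[≠] a) (𝓝 0) := by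
    have := (hG.mul hη).neg
    rw [mul_zero, neg_zero] at this
    exact this.congr' (hg.mono fun x hx => hx.symm)
  obtain ⟨c, h₁', h₀', hc, tB, tC, t1, t0, r0, ra, r1⟩ := tendsto_of_tendsto_const_entry
    (α₁ := α₁) (α₂ := α₂) (α₃ := α₃) ha₀ ha₁ he hG₀ (H₁ := h₁) (H₀ := h₀) (by
      filter_upwards [hres, hg, eventually_ne_nhdsNE a 0, eventually_ne_nhdsNE a 1]
        with x hx hgx x0 x1
      rw [hasResidueEigenvalues_iff x0 x1, hgx] at hx
      obtain ⟨s0, sx, s1⟩ := hx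
      exact ⟨by linear_combination s0, by linear_combination sx, by linear_combination s1⟩)
    hη hG hB
  refine ⟨c, h₁', h₀', hc, ?_, fun l l0 l1 la => ?_, fun α β q hsum hprod hq => ?_⟩
  · rw [hasResidueEigenvalues_iff ha₀ ha₁]
    exact ⟨by linear_combination r0, by linear_combination ra, by linear_combination r1⟩
  · exact tendsto_fuchsMatrix_numerator l0 l1 la tendsto_const_nhds tB tC t1 t0 hg₁ hG
  -- Seen from the second row the diagonal entry is the negative one, so `e`, `b` and `c` change
  -- sign; `accessoryBase` is even in its last argument.
  · refine equivalentToHeun_of_const (i := 1) (j := 0) (d := -e) (b := -b) (c := -c) (g := G₀)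
      (h₁ := h₁') (h₀ := h₀') one_ne_zero ha₀ ha₁ hG₀ (fun l => ?_) ?_ ?_ ?_ hsum ?_ ?_
    · refine ⟨?_, ?_, ?_, ?_⟩ <;> simp [numerator] <;> ring
    · linear_combination r0
    · linear_combination r1
    · linear_combination ra
    · rw [hprod]; ring
    · rw [hq]; simp only [accessoryBase]; ring

/-! ### The associated system -/

theorem IsAssociatedSystem.eventually {δ α₁ α₂ α₃ a : ℂ} {y : ℂ → ℂ} {D : LaxData}
    (h : IsAssociatedSystem δ α₁ α₂ α₃ a y D) :
    ∀ᶠ x in 𝓝[≠] a, x ≠ 0 ∧ x ≠ 1 ∧ D.κ x ≠ 0 ∧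
      D.z x = (x * (x - 1) * deriv y x - y x ^ 2 + y x) / 2 ∧
      HasResidueEigenvalues (numerator (-δ) (2 * δ * y x + D.p x)
        (-δ * y x ^ 2 - D.p x * y x + D.z x) (D.κ x) (-(D.κ x * y x)) (D.κt x) (-D.ω x))
        x α₁ α₂ α₃ := by
  filter_upwards [h, eventually_ne_nhdsNE a 0, eventually_ne_nhdsNE a 1]
    with x ⟨h1, h2, _, h4⟩ x0 x1
  rw [laxNumerator_eq] at h4
  refine ⟨x0, x1, h2, ?_, h4⟩
  have x1' := sub_ne_zero.2 x1
  rw [h1]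
  field_simp
  ring

/-! ### Simple poles -/

section SimplePole

variable {δ σ a : ℂ} {y f : ℂ → ℂ}

theorem hasSimplePoleExpansion_of_eq (hδ : δ ≠ 1 / 2) (hf : AnalyticAt ℂ f a)
    (hfa : 2 * (δ - 1 / 2) * f a = σ * (a * (a - 1)))
    (hy : ∀ᶠ x in 𝓝[≠] a, y x = f x / (x - a) ^ 1) :
    HasSimplePoleExpansion δ σ a (deriv f a) y := by
  have hδ' : δ - 1 / 2 ≠ 0 := sub_ne_zero.2 hδ
  have h := hasDerivAt_iff_tendsto_slope.1 hf.differentiableAt.hasDerivAt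
  refine h.congr' ?_
  filter_upwards [hy, eventually_ne_nhdsNE a a] with x hx hxa
  have hxa' := sub_ne_zero.2 hxa
  have : σ * (a * (a - 1) / (2 * (δ - 1 / 2))) = f a := by
    rw [← mul_div_assoc, ← hfa, mul_div_cancel_left₀ _ (mul_ne_zero two_ne_zero hδ')]
  rw [this, hx, slope_def_field]
  ring

theorem tendsto_sub_pow_mul_of_eq {n : ℕ} (hf : AnalyticAt ℂ f a)
    (hy : ∀ᶠ x in 𝓝[≠] a, y x = f x / (x - a) ^ n) :
    Tendsto (fun x => (x - a) ^ n * y x) (𝓝[≠] a) (𝓝 (f a)) := by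
  refine (hf.continuousAt.tendsto.mono_left nhdsWithin_le_nhds).congr' ?_
  filter_upwards [hy, eventually_ne_nhdsNE a a] with x hx hxa
  have hxa' := sub_ne_zero.2 hxa
  rw [hx]; field_simp

theorem tendsto_inv_of_eq {n : ℕ} (hn : n ≠ 0) (hf : AnalyticAt ℂ f a) (hfa : f a ≠ 0)
    (hy : ∀ᶠ x in 𝓝[≠] a, y x = f x / (x - a) ^ n) :
    Tendsto (fun x => (y x)⁻¹) (𝓝[≠] a) (𝓝 0) := by
  have h1 := (((tendsto_id_nhdsNE a).sub_const a).pow n).div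
    (hf.continuousAt.tendsto.mono_left nhdsWithin_le_nhds) hfa
  rw [sub_self, zero_pow hn, zero_div] at h1
  refine h1.congr' ?_
  filter_upwards [hy] with x hx
  rw [hx, inv_div]; rfl

theorem eventually_ne_zero_of_eq {n : ℕ} (hf : AnalyticAt ℂ f a) (hfa : f a ≠ 0)
    (hy : ∀ᶠ x in 𝓝[≠] a, y x = f x / (x - a) ^ n) : ∀ᶠ x in 𝓝[≠] a, y x ≠ 0 := by
  filter_upwards [hy, eventually_ne_nhdsNE a a,
    (hf.continuousAt.eventually_ne hfa).filter_mono nhdsWithin_le_nhds] with x hx hxa hfx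
  rw [hx]
  exact div_ne_zero hfx (pow_ne_zero _ (sub_ne_zero.2 hxa))

/-- The expression is `B + η C` of the original system for `σ = 1`, and of the system transformed by
`R₀` for `σ = -1`. Its polar parts combine to `F / (x - a)`, where `F a = 0` by the choice of
residue, so the limit is a derivative of `F` plus a regular term. -/
theorem tendsto_logDeriv_combination
    (hf : AnalyticAt ℂ f a) (hf0 : f a ≠ 0)
    (hfa : 2 * (δ - 1 / 2) * f a = σ * (a * (a - 1)))
    (hy : ∀ᶠ x in 𝓝[≠] a, y x = f x / (x - a) ^ 1) :
    Tendsto (fun x => (δ - 1 / 2) * y x + σ / 2 * (x * (x - 1) * (deriv y x / y x) + 1))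
      (𝓝[≠] a) (𝓝 ((2 * δ - 1) * deriv f a + σ * (1 - a))) := by
  set F : ℂ → ℂ := fun x => (δ - 1 / 2) * f x - σ / 2 * (x * (x - 1)) with hF
  have hFd : HasDerivAt F ((δ - 1 / 2) * deriv f a - σ / 2 * (2 * a - 1)) a :=
    ((hf.differentiableAt.hasDerivAt.const_mul (δ - 1 / 2)).fun_sub
      (((hasDerivAt_id' a).fun_mul ((hasDerivAt_id' a).sub_const 1)).const_mul
        (σ / 2))).congr_deriv (by ring)
  have hFa : F a = 0 := by simp only [hF]; linear_combination hfa / 2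
  have hs := hasDerivAt_iff_tendsto_slope.1 hFd
  have hx := tendsto_id_nhdsNE a
  have hlim := hs.add (((((hx.mul (hx.sub_const 1)).mul
    ((hf.deriv.continuousAt.tendsto.mono_left nhdsWithin_le_nhds).div
    (hf.continuousAt.tendsto.mono_left nhdsWithin_le_nhds) hf0)).add_const 1)).const_mul (σ / 2))
  have ht : (δ - 1 / 2) * deriv f a - σ / 2 * (2 * a - 1)
      + σ / 2 * (a * (a - 1) * (deriv f a / f a) + 1)
      = (2 * δ - 1) * deriv f a + σ * (1 - a) := by
    have : σ * (a * (a - 1) * (deriv f a / f a)) = 2 * (δ - 1 / 2) * deriv f a := by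
      field_simp
      linear_combination -(deriv f a) * hfa
    linear_combination this / 2
  rw [ht] at hlim
  refine hlim.congr' ?_
  filter_upwards [hy, eventually_hasDerivAt_of_eq_div_pow hf hy, eventually_ne_nhdsNE a a,
    (hf.continuousAt.eventually_ne hf0).filter_mono nhdsWithin_le_nhds] with x h1 h2 hxa hfx
  have hxa' := sub_ne_zero.2 hxa
  rw [h2, h1, slope_def_field, hFa]
  simp only [hF, Pi.div_apply]
  field_simp
  push_cast
  ring

theorem exists_tendsto_gauge_of_simplePole {α₁ α₂ α₃ : ℂ} (hσ : σ = 1 ∨ σ = -1) (ha₀ : a ≠ 0)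
    (ha₁ : a ≠ 1) (hf : AnalyticAt ℂ f a) (hfa : 2 * (δ - 1 / 2) * f a = σ * (a * (a - 1)))
    (hy : ∀ᶠ x in 𝓝[≠] a, y x = f x / (x - a) ^ 1) {D : LaxData}
    (hD : IsAssociatedSystem δ α₁ α₂ α₃ a y D) :
    ∃ κ₀ : ℂ, κ₀ ≠ 0 ∧ (σ = 1 → Tendsto (fun x => D.κ x / (x - a)) (𝓝[≠] a) (𝓝 κ₀)) ∧
      (σ = -1 → Tendsto (fun x => D.κ x * (x - a)) (𝓝[≠] a) (𝓝 κ₀)) := by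
  have ha₁' := sub_ne_zero.2 ha₁
  -- The logarithmic derivative of `κ` is `F / (x - a)`. Since `F a = σ`, removing the factor `(x -
  -- a)^σ` from `κ` leaves the holomorphic logarithmic derivative `dslope F a`.
  set F : ℂ → ℂ := fun x => (2 * δ - 1) * (f x - x * (x - a)) / (x * (x - 1)) with hF
  have hFan : AnalyticAt ℂ F a :=
    AnalyticAt.div (by fun_prop) (by fun_prop) (mul_ne_zero ha₀ ha₁')
  have hFa : F a = σ := by
    simp only [hF]
    rw [div_eq_iff (mul_ne_zero ha₀ ha₁')]
    linear_combination hfa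
  have hFd := Complex.analyticAt_iff_eventually_differentiableAt.1 hFan
  have hsl : DifferentiableOn ℂ (dslope F a) {x | DifferentiableAt ℂ F x} :=
    (Complex.differentiableOn_dslope hFd).2 fun x hx => hx.differentiableWithinAt
  have hsx : ∀ x, x ≠ a → dslope F a x = (F x - σ) / (x - a) := fun x hx => by
    rw [dslope_of_ne _ hx, slope_def_field, hFa]
  have key : ∀ᶠ x in 𝓝[≠] a, x ≠ a ∧ D.κ x ≠ 0 ∧
      HasDerivAt D.κ ((dslope F a x + σ / (x - a)) * D.κ x) x := by
    filter_upwards [hD, hy, eventually_ne_nhdsNE a a, eventually_ne_nhdsNE a 0,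
      eventually_ne_nhdsNE a 1] with x ⟨_, h2, h3, _⟩ hyx hxa x0 x1
    refine ⟨hxa, h2, h3.congr_deriv ?_⟩
    have hxa' := sub_ne_zero.2 hxa
    have x1' := sub_ne_zero.2 x1
    rw [hyx, hsx x hxa]
    simp only [hF]
    field_simp
    ring
  rcases hσ with rfl | rfl
  · obtain ⟨κ₀, h0, h1⟩ := exists_tendsto_ne_zero_of_logDeriv (K := fun x => D.κ x / (x - a))
      hFd hsl (by
        filter_upwards [key] with x ⟨hxa, hk, hd⟩
        have hxa' := sub_ne_zero.2 hxa
        refine ⟨div_ne_zero hk hxa', (hd.fun_div ((hasDerivAt_id' x).sub_const a)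
          hxa').congr_deriv ?_⟩
        field_simp
        ring)
    exact ⟨κ₀, h0, fun _ => h1, fun h => by norm_num at h⟩
  · obtain ⟨κ₀, h0, h1⟩ := exists_tendsto_ne_zero_of_logDeriv (K := fun x => D.κ x * (x - a))
      hFd hsl (by
        filter_upwards [key] with x ⟨hxa, hk, hd⟩
        have hxa' := sub_ne_zero.2 hxa
        refine ⟨mul_ne_zero hk hxa', (hd.fun_mul ((hasDerivAt_id' x).sub_const a)).congr_deriv ?_⟩
        field_simp
        ring)
    exact ⟨κ₀, h0, fun h => by norm_num at h, fun _ => h1⟩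

end SimplePole

theorem tendsto_norm_upper_entry {δ a : ℂ} {y : ℂ → ℂ} {D : LaxData} {n : ℕ} {c : ℂ} (hn : n ≠ 0)
    (hc : c ≠ 0) (hy : Tendsto (fun x => (y x)⁻¹) (𝓝[≠] a) (𝓝 0))
    (hy0 : ∀ᶠ x in 𝓝[≠] a, y x ≠ 0)
    (hκ : Tendsto (fun x => (x - a) ^ n * (D.κ x * y x)) (𝓝[≠] a) (𝓝 c)) {l : ℂ} (h0 : l ≠ 0)
    (h1 : l ≠ 1) (ha : l ≠ a) :
    Tendsto (fun x => ‖laxMatrix δ y D x l 0 1‖) (𝓝[≠] a) atTop := by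
  have hx := tendsto_id_nhdsNE a
  have hnum : Tendsto (fun x => (l * (l - 1) * (l - x))⁻¹ * ((x - a) ^ n * (D.κ x * y x)) *
      (l * (y x)⁻¹ - 1)) (𝓝[≠] a) (𝓝 ((l * (l - 1) * (l - a))⁻¹ * c * (l * 0 - 1))) :=
    ((((hx.const_sub l).const_mul (l * (l - 1))).inv₀ (cubic_ne_zero h0 h1 ha)).mul hκ).mul
      ((hy.const_mul l).sub_const 1)
  have hinv : Tendsto (fun x => ‖((x - a) ^ n)⁻¹‖) (𝓝[≠] a) atTop := by
    have h2 : Tendsto (fun x : ℂ => (x - a) ^ n) (𝓝[≠] a) (𝓝[≠] 0) := by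
      refine tendsto_nhdsWithin_iff.2 ⟨?_, ?_⟩
      · simpa [hn] using (hx.sub_const a).pow n
      · filter_upwards [eventually_ne_nhdsNE a a] with x hxa
        exact pow_ne_zero _ (sub_ne_zero.2 hxa)
    exact tendsto_norm_inv_nhdsNE_zero_atTop.comp h2
  refine (hinv.atTop_mul_pos (norm_pos_iff.2 ?_) hnum.norm).congr' ?_
  · exact mul_ne_zero (mul_ne_zero (inv_ne_zero (cubic_ne_zero h0 h1 ha)) hc) (by norm_num)
  · filter_upwards [hy0, eventually_ne_nhdsNE a a] with x hyx hxa
    have hxa' := sub_ne_zero.2 hxa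
    rw [← norm_mul]
    congr 1
    simp only [laxMatrix, fuchsMatrix, laxNumerator, Matrix.smul_apply, smul_eq_mul,
      Matrix.of_apply, Matrix.cons_val', Matrix.cons_val_zero, Matrix.cons_val_one,
      Matrix.cons_val_fin_one]
    field_simp

/-! ### Simple poles with a regular or a generic singular coefficient matrix -/

theorem laxMatrix_eq (δ : ℂ) (y : ℂ → ℂ) (D : LaxData) (x : ℂ) :
    laxMatrix δ y D x = fuchsMatrix (numerator (-δ) (2 * δ * y x + D.p x)
      (-δ * y x ^ 2 - D.p x * y x + D.z x) (D.κ x) (-(D.κ x * y x)) (D.κt x) (-D.ω x)) x := by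
  funext l
  rw [laxMatrix, laxNumerator_eq]

section SimplePole

variable {δ α₁ α₂ α₃ a : ℂ} {y f : ℂ → ℂ} {D : LaxData}

/-- The coefficient matrix converges at a simple pole with residue `a (a-1) / (2δ-1)`. -/
theorem regular_case (hδ₀ : δ ≠ 0) (hδ : δ ≠ 1 / 2) (ha₀ : a ≠ 0) (ha₁ : a ≠ 1)
    (hf : AnalyticAt ℂ f a) (hf0 : f a ≠ 0) (hfa : 2 * (δ - 1 / 2) * f a = 1 * (a * (a - 1)))
    (hy : ∀ᶠ x in 𝓝[≠] a, y x = f x / (x - a) ^ 1)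
    (hD : IsAssociatedSystem δ α₁ α₂ α₃ a y D) {κ₀ : ℂ} (hκ₀ : κ₀ ≠ 0)
    (hκ : Tendsto (fun x => D.κ x / (x - a)) (𝓝[≠] a) (𝓝 κ₀)) :
    ∃ b₃ c₃ cp bm cm : ℂ,
      b₃ = deriv f a * (2 * δ - 1) + 1 - a ∧
      c₃ = 1 / (2 * δ) * ((δ - 1 - deriv f a * (2 * δ - 1)) ^ 2 - a * α₁ ^ 2
        + (a - 1) * α₃ ^ 2 - a * (a - 1) * α₂ ^ 2
        + a * (δ ^ 2 - 2 - 2 * deriv f a * (2 * δ ^ 2 + δ - 1)) + a ^ 2 * (δ + 1) ^ 2) ∧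
      cp = -κ₀ * (a * (a - 1) / (2 * δ - 1)) ∧
      HasResidueEigenvalues (numerator (-δ) b₃ c₃ 0 cp bm cm) a α₁ α₂ α₃ ∧
      (∀ l : ℂ, l ≠ 0 → l ≠ 1 → l ≠ a →
        Tendsto (fun x => laxMatrix δ y D x l) (𝓝[≠] a)
          (𝓝 (fuchsMatrix (numerator (-δ) b₃ c₃ 0 cp bm cm) a l))) ∧
      EquivalentToHeun (fuchsMatrix (numerator (-δ) b₃ c₃ 0 cp bm cm) a) 0 α₁ α₂ α₃
        a (1 - 2 * α₁) (1 - 2 * α₃) (1 - 2 * α₂)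
        (δ - (α₁ + α₂ + α₃)) (2 - δ - (α₁ + α₂ + α₃))
        (-(accessoryBase α₁ α₂ α₃ a δ + b₃ * (2 * δ - 1))) := by
  have hδ' : 2 * δ - 1 ≠ 0 := fun h => hδ (by linear_combination h / 2)
  have hfa' : f a = a * (a - 1) / (2 * δ - 1) := by
    rw [eq_div_iff hδ']; linear_combination hfa
  have hy0 := eventually_ne_zero_of_eq hf hf0 hy
  have hG : Tendsto (fun x => -(D.κ x * y x)) (𝓝[≠] a) (𝓝 (-(κ₀ * f a))) := by
    refine (hκ.mul (tendsto_sub_pow_mul_of_eq hf hy)).neg.congr' ?_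
    filter_upwards [eventually_ne_nhdsNE a a] with x hxa
    have := sub_ne_zero.2 hxa
    field_simp
  obtain ⟨c, h₁, h₀, hc, hres, hlim, hH⟩ := exists_limit_upper ha₀ ha₁ hδ₀
    (neg_ne_zero.2 (mul_ne_zero hκ₀ hf0)) (hD.eventually.mono fun x hx => hx.2.2.2.2)
    (hy0.mono fun x hx => by field_simp) (tendsto_inv_of_eq one_ne_zero hf hf0 hy) hG
    -- Here `η = 1/y`, and `B + C/y = δ y + z/y`: the unknown `p` cancels.
    ((tendsto_logDeriv_combination hf hf0 hfa hy).congr' (by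
      filter_upwards [hD.eventually, hy0] with x ⟨x0, x1, _, hz, _⟩ hyx
      rw [hz]
      field_simp
      ring))
  refine ⟨_, c, _, h₁, h₀, ?_, ?_, ?_, hres, ?_, hH _ _ _ (by ring) (by ring) rfl⟩
  · ring
  · rw [hc]; ring
  · rw [hfa']; ring
  · simpa only [laxMatrix_eq] using hlim

/-- After the transformation `schlesinger₀` the coefficient matrix converges at a simple pole with
residue `-a (a-1) / (2δ-1)`. -/
theorem generic_singular_case (hδ₁ : δ ≠ 1) (hδ : δ ≠ 1 / 2) (ha₀ : a ≠ 0) (ha₁ : a ≠ 1)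
    (hf : AnalyticAt ℂ f a) (hf0 : f a ≠ 0) (hfa : 2 * (δ - 1 / 2) * f a = -1 * (a * (a - 1)))
    (hy : ∀ᶠ x in 𝓝[≠] a, y x = f x / (x - a) ^ 1)
    (hD : IsAssociatedSystem δ α₁ α₂ α₃ a y D) {κ₀ : ℂ} (hκ₀ : κ₀ ≠ 0)
    (hκ : Tendsto (fun x => D.κ x * (x - a)) (𝓝[≠] a) (𝓝 κ₀)) :
    ∃ b₃ c₃ cm bp cp : ℂ,
      b₃ = a - 1 + deriv f a * (2 * δ - 1) ∧
      c₃ = 1 / (2 * (δ - 1)) * (a ^ 2 * ((δ - 2) ^ 2 - α₂ ^ 2)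
        + a * (-α₁ ^ 2 + α₃ ^ 2 + α₂ ^ 2 + (δ - 1) ^ 2 - 2
          - deriv f a * (4 * (δ - 1) ^ 2 - 2 * δ))
        - α₃ ^ 2 + (δ - deriv f a * (2 * δ - 1)) ^ 2) ∧
      cm = -(a * (a - 1) * (2 * δ - 1) / κ₀) ∧
      HasResidueEigenvalues (numerator (1 - δ) b₃ c₃ bp cp 0 cm) a α₁ α₂ α₃ ∧
      (∀ᶠ x in 𝓝[≠] a, ∀ l : ℂ, (schlesinger₀ δ y D x l).det = 1) ∧
      (∀ l : ℂ, l ≠ 0 → l ≠ 1 → l ≠ a →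
        Tendsto (fun x => gaugeTransform (schlesinger₀ δ y D x) (laxMatrix δ y D x) l)
          (𝓝[≠] a) (𝓝 (fuchsMatrix (numerator (1 - δ) b₃ c₃ bp cp 0 cm) a l))) ∧
      EquivalentToHeun (fuchsMatrix (numerator (1 - δ) b₃ c₃ bp cp 0 cm) a) 1 α₁ α₂ α₃
        a (1 - 2 * α₁) (1 - 2 * α₃) (1 - 2 * α₂)
        (1 + δ - (α₁ + α₂ + α₃)) (1 - δ - (α₁ + α₂ + α₃))
        (-(accessoryBase α₁ α₂ α₃ a (δ - 1) + b₃ * (2 * δ - 1))) := by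
  have hδ' : 2 * δ - 1 ≠ 0 := fun h => hδ (by linear_combination h / 2)
  have hδ₁' : δ - 1 ≠ 0 := sub_ne_zero.2 hδ₁
  have hfa' : f a = -(a * (a - 1) / (2 * δ - 1)) := by
    rw [← neg_div, eq_div_iff hδ']; linear_combination hfa
  have hy0 := eventually_ne_zero_of_eq hf hf0 hy
  set r : ℂ → ℂ := fun x => (1 + x - 2 * D.p x - y x * (2 * δ + 1)) / (2 * (δ - 1)) with hr
  set k : ℂ → ℂ := fun x => D.κ x / (2 * δ - 1) with hk
  set B : ℂ → ℂ := fun x => 2 * δ * y x + D.p x with hB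
  set C : ℂ → ℂ := fun x => -δ * y x ^ 2 - D.p x * y x + D.z x with hC
  have hR : ∀ x, schlesinger₀ δ y D x = fun l => !![l + r x, -k x; (k x)⁻¹, 0] := by
    intro x
    funext l
    simp only [schlesinger₀, hr, hk, inv_div]
  have hk0 : ∀ᶠ x in 𝓝[≠] a, k x ≠ 0 :=
    hD.eventually.mono fun x hx => div_ne_zero hx.2.2.1 hδ'
  have hgk : ∀ x, D.κ x = (-2 * (-δ) - 1) * k x := by
    intro x; simp only [hk]; field_simp
  have hrk : ∀ x, 2 * k x * (B x + -δ * r x) + -(D.κ x * y x) + 2 * D.κ x * r x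
      = k x * (1 + x) := by
    intro x
    rw [hgk]
    simp only [hr, hB]
    field_simp
    ring
  have hG : Tendsto (fun x => -(-(D.κ x * y x)) / k x ^ 2) (𝓝[≠] a)
      (𝓝 ((2 * δ - 1) ^ 2 * (f a / κ₀))) := by
    refine (((tendsto_sub_pow_mul_of_eq hf hy).div hκ hκ₀).const_mul _).congr' ?_
    filter_upwards [eventually_ne_nhdsNE a a, hD.eventually] with x hxa ⟨_, _, hκx, _⟩
    have := sub_ne_zero.2 hxa
    simp only [hk, Pi.div_apply]
    field_simp
  obtain ⟨c, h₁, h₀, hc, hres, hlim, hH⟩ := exists_limit_lower (e := δ - 1)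
    (α₁ := α₁) (α₂ := α₂) (α₃ := α₃) (η := fun x => (y x)⁻¹) ha₀ ha₁ hδ₁'
    (mul_ne_zero (pow_ne_zero 2 hδ') (div_ne_zero hf0 hκ₀))
    (by
      filter_upwards [hD.eventually, hk0] with x ⟨x0, x1, _, _, hx⟩ hkx
      have := hasResidueEigenvalues_upper hkx x0 x1 (hgk x) (hrk x) hx
      rwa [show 1 + -δ = -(δ - 1) by ring] at this)
    (hy0.mono fun x hx => by field_simp) (tendsto_inv_of_eq one_ne_zero hf hf0 hy) hG
    -- Both `p` and `r` cancel, and `B + η C` of the transformed system is `(δ - 1) y - z/y`.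
    ((tendsto_logDeriv_combination hf hf0 hfa hy).congr' (by
      filter_upwards [hD.eventually, hy0, hk0] with x ⟨x0, x1, _, hz, _⟩ hyx hkx
      rw [hgk, hz]
      field_simp
      ring))
  rw [neg_sub] at hres hlim hH
  refine ⟨_, c, _, h₁, h₀, ?_, ?_, ?_, hres, ?_, fun l l0 l1 la => ?_,
    hH _ _ _ (by ring) (by ring) (by ring)⟩
  · ring
  · rw [hc]; ring
  · rw [hfa']; field_simp
  · filter_upwards [hk0] with x hkx l
    rw [hR, Matrix.det_fin_two_of]
    field_simp
    ring
  · refine (hlim l l0 l1 la).congr' ?_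
    filter_upwards [hk0, eventually_ne_nhdsNE a l, hD.eventually,
      (tendsto_id_nhdsNE a).eventually_ne la.symm] with x hkx hxl hx hxl'
    rw [hR, laxMatrix_eq, gaugeTransform_upper hkx l0 l1 hxl'.symm _ _ _ _ _ _ _
      (hgk x) (hrk x), show 1 + -δ = 1 - δ by ring]

end SimplePole

/-! ### The coefficient `p` -/

/-- Divide the relations at `l = 0, 1, x` by `l - y` and take the second divided difference: the
linear lower left entry, hence `κt` and `ω`, disappears. -/
theorem formula_p {δ α₁ α₂ α₃ x y p z κ κt ω : ℂ} (hx₀ : x ≠ 0) (hx₁ : x ≠ 1) (hy₀ : y ≠ 0)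
    (hy₁ : y ≠ 1) (hyx : y ≠ x)
    (h : HasResidueEigenvalues (numerator (-δ) (2 * δ * y + p) (-δ * y ^ 2 - p * y + z) κ
      (-(κ * y)) κt (-ω)) x α₁ α₂ α₃) :
    2 * δ * p = δ ^ 2 * (1 + x - 3 * y) - z ^ 2 / (y * (y - 1) * (y - x)) + α₁ ^ 2 * x / y
      + α₃ ^ 2 * (1 - x) / (y - 1) + α₂ ^ 2 * (x * (x - 1)) / (y - x) := by
  rw [hasResidueEigenvalues_iff hx₀ hx₁] at h
  obtain ⟨h0, hx, h1⟩ := h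
  have x1 := sub_ne_zero.2 hx₁
  have x1' := sub_ne_zero.2 hx₁.symm
  have y1 := sub_ne_zero.2 hy₁
  have yx := sub_ne_zero.2 hyx
  have q0 : α₁ ^ 2 * x = ((-δ * y ^ 2 - p * y + z) ^ 2 + -(κ * y) * -ω) / x := by
    rw [h0]; field_simp
  have q1 : α₃ ^ 2 * (1 - x) = ((-δ + (2 * δ * y + p) + (-δ * y ^ 2 - p * y + z)) ^ 2
      + (κ + -(κ * y)) * (κt + -ω)) / (1 - x) := by
    rw [h1]; field_simp
  have qx : α₂ ^ 2 * (x * (x - 1)) = ((-δ * x ^ 2 + (2 * δ * y + p) * x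
      + (-δ * y ^ 2 - p * y + z)) ^ 2 + (κ * x + -(κ * y)) * (κt * x + -ω)) / (x * (x - 1)) := by
    rw [hx]; field_simp
  rw [q0, q1, qx, show 1 - x = -(x - 1) by ring]
  field_simp
  ring

theorem eventually_inv_ne {a c : ℂ} {y : ℂ → ℂ} (hy : Tendsto (fun x => (y x)⁻¹) (𝓝[≠] a) (𝓝 0))
    {φ : ℂ → ℂ} (hφ : Tendsto φ (𝓝[≠] a) (𝓝 c)) : ∀ᶠ x in 𝓝[≠] a, 1 - φ x * (y x)⁻¹ ≠ 0 :=
  ((hφ.mul hy).const_sub 1).eventually_ne (by simp)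

/-! ### The special singular case -/

/-- The Schlesinger transformation `schlesinger₁` preserves the eigenvalues of the residues
at `1` and `x`. -/
theorem residue_relations_sqrt {g k y w x f₁ f₀ h₁ h₀ r₁ rx : ℂ} (hk : k ≠ 0)
    (hf₀ : f₀ = g * y - w) (hh₀ : h₀ = -((2 * w - g * y) * g / k))
    (e1 : (-1 + f₁ + f₀) ^ 2 + (k + -(k * y)) * (h₁ + h₀) = r₁)
    (ex : (-1 * x ^ 2 + f₁ * x + f₀) ^ 2 + (k * x + -(k * y)) * (h₁ * x + h₀) = rx) :
    (-(1 / 2) + (f₁ - g - (1 + x) / 2) + (-(k * h₁ - 2 * g * f₁ - g ^ 2) - w + x / 2)) ^ 2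
      + (k * (2 * f₁ - y - 1 - x) + k * (-(k * h₁ - 2 * g * f₁ - g ^ 2) + x - 2 * w))
        * (2 * g / k + (k * h₁ - 2 * g * f₁ - g ^ 2) / k) = r₁ ∧
    (-(1 / 2) * x ^ 2 + (f₁ - g - (1 + x) / 2) * x
        + (-(k * h₁ - 2 * g * f₁ - g ^ 2) - w + x / 2)) ^ 2
      + (k * (2 * f₁ - y - 1 - x) * x + k * (-(k * h₁ - 2 * g * f₁ - g ^ 2) + x - 2 * w))
        * (2 * g / k * x + (k * h₁ - 2 * g * f₁ - g ^ 2) / k) = rx := by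
  subst hf₀ hh₀
  constructor
  · rw [← e1]; field_simp; ring
  · rw [← ex]; field_simp; ring

/-- Convergence of a linear function from the convergence of its values at `1` and `x`. -/
theorem tendsto_coeffs_of_values {a P Q : ℂ} (ha₁ : a ≠ 1) {g₁ g₀ : ℂ → ℂ}
    (h1 : Tendsto (fun x => g₁ x + g₀ x) (𝓝[≠] a) (𝓝 P))
    (hx : Tendsto (fun x => g₁ x * x + g₀ x) (𝓝[≠] a) (𝓝 Q)) :
    Tendsto g₁ (𝓝[≠] a) (𝓝 ((Q - P) / (a - 1))) ∧
      Tendsto g₀ (𝓝[≠] a) (𝓝 (P - (Q - P) / (a - 1))) := by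
  have t1 : Tendsto g₁ (𝓝[≠] a) (𝓝 ((Q - P) / (a - 1))) := by
    refine ((hx.sub h1).div ((tendsto_id_nhdsNE a).sub_const 1) (sub_ne_zero.2 ha₁)).congr' ?_
    filter_upwards [eventually_ne_nhdsNE a 1] with x x1
    have := sub_ne_zero.2 x1
    simp only [Pi.div_apply]
    field_simp
    ring
  exact ⟨t1, (h1.sub t1).congr fun x => by ring⟩

theorem special_singular_case {α₁ α₂ α₃ a : ℂ} {y f : ℂ → ℂ} {D : LaxData}
    (ha₀ : a ≠ 0) (ha₁ : a ≠ 1)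
    (hf : AnalyticAt ℂ f a) (hf0 : f a ≠ 0)
    (hfa : 2 * ((1 : ℂ) - 1 / 2) * f a = -1 * (a * (a - 1)))
    (hy : ∀ᶠ x in 𝓝[≠] a, y x = f x / (x - a) ^ 1)
    (hD : IsAssociatedSystem 1 α₁ α₂ α₃ a y D) {κ₀ : ℂ} (hκ₀ : κ₀ ≠ 0)
    (hκ : Tendsto (fun x => D.κ x * (x - a)) (𝓝[≠] a) (𝓝 κ₀)) :
    ∃ b₃ c₃ bp cp bm : ℂ,
      b₃ = deriv f a + 3 / 2 * a - 1 / 2 ∧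
      c₃ = a * (α₁ - 1 / 2) ∧
      bp = κ₀ / (a * (a - 1)) * (a ^ 2 * (1 - α₂ ^ 2)
        - a * (2 + α₁ ^ 2 - α₃ ^ 2 - α₂ ^ 2 - 2 * deriv f a) - α₃ ^ 2 + (deriv f a - 1) ^ 2) ∧
      cp = κ₀ * (-α₃ ^ 2 + α₂ ^ 2 + (a + 1) / (a - 1) * α₁ ^ 2
        + 2 * α₁ * (deriv f a / (a - 1) + 1)) ∧
      bm = -(a * (a - 1) / κ₀) ∧
      HasResidueEigenvalues (numerator (-(1 / 2)) b₃ c₃ bp cp bm 0) a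
        (α₁ - 1 / 2) α₂ α₃ ∧
      (∀ (U : Set ℂ) (s : ℂ → ℂ), IsOpen U → 0 ∉ U → 1 ∉ U → a ∉ U → IsSqrtBranch s U →
        (∀ᶠ x in 𝓝[≠] a, ∀ l ∈ U, (schlesinger₁ α₁ y D s x l).det = 1) ∧
        ∀ l ∈ U, Tendsto
          (fun x => gaugeTransform (schlesinger₁ α₁ y D s x) (laxMatrix 1 y D x) l)
          (𝓝[≠] a) (𝓝 (fuchsMatrix (numerator (-(1 / 2)) b₃ c₃ bp cp bm 0) a l))) ∧
      EquivalentToHeun (fuchsMatrix (numerator (-(1 / 2)) b₃ c₃ bp cp bm 0) a) 1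
        (α₁ - 1 / 2) α₂ α₃
        a (1 - 2 * α₁) (1 - 2 * α₃) (1 - 2 * α₂)
        (2 - (α₁ + α₂ + α₃)) (-(α₁ + α₂ + α₃))
        (-(b₃ - 1 / 2 * (a + 1) + accessoryBase α₁ α₂ α₃ a 0)) := by
  have ha₁' := sub_ne_zero.2 ha₁
  have hfa' : f a = -(a * (a - 1)) := by linear_combination hfa
  have hy0 := eventually_ne_zero_of_eq hf hf0 hy
  have hη := tendsto_inv_of_eq one_ne_zero hf hf0 hy
  have hx := tendsto_id_nhdsNE a
  set η : ℂ → ℂ := fun x => (y x)⁻¹ with hηdef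
  set ζ : ℂ → ℂ := fun x => D.z x / y x with hζdef
  set c₀ := deriv f a
  have hζ : Tendsto ζ (𝓝[≠] a) (𝓝 (1 - a - c₀)) := by
    have h := (tendsto_logDeriv_combination hf hf0 hfa hy).neg
    rw [show -((2 * 1 - 1) * deriv f a + -1 * (1 - a)) = 1 - a - c₀ by simp only [c₀]; ring] at h
    refine h.congr' ?_
    filter_upwards [hD.eventually, hy0] with x ⟨_, _, _, hz, _⟩ hyx
    simp only [hζdef]
    rw [hz]
    field_simp
    ring
  have n1 : ∀ᶠ x in 𝓝[≠] a, 1 - 1 * η x ≠ 0 := eventually_inv_ne hη tendsto_const_nhds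
  have nx : ∀ᶠ x in 𝓝[≠] a, 1 - x * η x ≠ 0 := eventually_inv_ne hη hx
  set g : ℂ → ℂ := schlesingerG₁ α₁ y D with hgdef
  set B : ℂ → ℂ := fun x => 2 * 1 * y x + D.p x with hBdef
  set ε : ℂ → ℂ := fun x => 2 * B x - y x - 1 - x with hεdef
  set h : ℂ → ℂ := fun x => D.κ x * D.κt x - 2 * g x * B x - g x ^ 2 with hhdef
  have hg : ∀ x, g x = y x / 2 - (1 + x) / 2 + ζ x + α₁ * x * η x - ε x / 2 := by
    intro x
    simp only [hgdef, schlesingerG₁, hζdef, hηdef, hεdef, hBdef]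
    ring
  -- By `formula_p` with `δ = 1`, `ε` is `1/y` times a bounded quantity, because `z/y` converges.
  have hε : Tendsto ε (𝓝[≠] a) (𝓝 0) := by
    have hlim : Tendsto (fun x => η x * (α₁ ^ 2 * x - ζ x ^ 2 / ((1 - 1 * η x) * (1 - x * η x))
        + α₃ ^ 2 * (1 - x) / (1 - 1 * η x) + α₂ ^ 2 * (x * (x - 1)) / (1 - x * η x)))
        (𝓝[≠] a) (𝓝 (0 * (α₁ ^ 2 * a - (1 - a - c₀) ^ 2 / ((1 - 1 * 0) * (1 - a * 0))
          + α₃ ^ 2 * (1 - a) / (1 - 1 * 0) + α₂ ^ 2 * (a * (a - 1)) / (1 - a * 0)))) := by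
      have u1 := (hη.const_mul 1).const_sub 1
      have ux := (hx.mul hη).const_sub 1
      exact hη.mul ((((hx.const_mul _).sub ((hζ.pow 2).div (u1.mul ux) (by simp))).add
        (((hx.const_sub 1).const_mul _).div u1 (by simp))).add
        (((hx.mul (hx.sub_const 1)).const_mul _).div ux (by simp)))
    rw [zero_mul] at hlim
    refine hlim.congr' ?_
    filter_upwards [hD.eventually, hy0, n1, nx] with x ⟨x0, x1, _, _, hr⟩ hyx n1 nx
    have hy1 : y x - 1 ≠ 0 := fun h => n1 (by simp only [hηdef]; field_simp; rw [h, mul_zero])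
    have hyx' : y x - x ≠ 0 := fun h => nx (by simp only [hηdef]; field_simp; rw [h, mul_zero])
    have hp := formula_p x0 x1 hyx (sub_ne_zero.1 hy1) (sub_ne_zero.1 hyx') hr
    have hp' : ε x = - D.z x ^ 2 / (y x * (y x - 1) * (y x - x)) + α₁ ^ 2 * x / y x
      + α₃ ^ 2 * (1 - x) / (y x - 1) + α₂ ^ 2 * (x * (x - 1)) / (y x - x) := by
      simp only [hεdef, hBdef]
      linear_combination hp
    rw [hp']
    have e1 : 1 - 1 * η x = (y x - 1) / y x := by simp only [hηdef]; field_simp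
    have e2 : 1 - x * η x = (y x - x) / y x := by simp only [hηdef]; field_simp
    rw [e1, e2]
    simp only [hηdef, hζdef]
    field_simp
    ring
  -- The relation at `0` in factored form: `g` is chosen so that the constant diagonal coefficient
  -- is `g y - α₁ x`. These are the two hypotheses of `gaugeTransform_sqrt` with `w = α₁ x`.
  have hω : ∀ᶠ x in 𝓝[≠] a, -D.ω x = -((2 * (α₁ * x) - g x * y x) * g x / D.κ x) ∧
      -1 * y x ^ 2 - D.p x * y x + D.z x = g x * y x - α₁ * x := by
    filter_upwards [hD.eventually, hy0] with x ⟨x0, x1, hk, _, hr⟩ hyx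
    have hC : -1 * y x ^ 2 - D.p x * y x + D.z x = g x * y x - α₁ * x := by
      simp only [hgdef, schlesingerG₁]
      field_simp
      ring
    refine ⟨?_, hC⟩
    rw [hasResidueEigenvalues_iff x0 x1, hC] at hr
    rw [neg_inj, eq_div_iff hk]
    refine mul_left_cancel₀ hyx ?_
    linear_combination hr.1
  -- The relation at `1` determines `h (y - 1)`. Since `g` and `B` both grow like `y/2`, the terms
  -- quadratic in `y` cancel and `h` stays bounded.
  have hh : Tendsto h (𝓝[≠] a) (𝓝 (a - 2 * α₁ * a)) := by
    have hw : Tendsto (fun x => ζ x - α₁ * x + α₁ * x * η x) (𝓝[≠] a)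
        (𝓝 (1 - a - c₀ - α₁ * a + α₁ * a * 0)) :=
      (hζ.sub (hx.const_mul α₁)).add ((hx.const_mul α₁).mul hη)
    have hlim := ((hx.sub (hx.const_mul (2 * α₁))).add hε).add
      ((((hw.pow 2).sub (((hx.const_sub 1).pow 2).const_mul (α₃ ^ 2))).mul hη).div
        ((hη.const_mul 1).const_sub 1) (by simp))
    simp only [mul_zero, zero_div, add_zero] at hlim
    refine hlim.congr' ?_
    filter_upwards [hD.eventually, hy0, n1, hω] with x ⟨x0, x1, hk, _, hr⟩ hyx n1 ⟨hωx, hC⟩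
    rw [hasResidueEigenvalues_iff x0 x1, hC, hωx] at hr
    obtain ⟨-, -, r1⟩ := hr
    have hy1 : y x - 1 ≠ 0 := fun h => n1 (by simp only [hηdef]; field_simp; rw [h, mul_zero])
    have e1 : 1 - 1 * η x = (y x - 1) / y x := by simp only [hηdef]; field_simp
    have hgB : ζ x - α₁ * x + α₁ * x * η x = g x + B x - y x - α₁ * x := by
      rw [hg]; simp only [hεdef]; ring
    have key : h x * (y x - 1) = -2 * g x * (y x - 1) + (g x + B x - 1 - α₁ * x) ^ 2
        - α₃ ^ 2 * (1 - x) ^ 2 := by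
      have e2 : D.κ x * (-((2 * (α₁ * x) - g x * y x) * g x / D.κ x))
        = -((2 * (α₁ * x) - g x * y x) * g x) := by field_simp
      simp only [hhdef, hBdef]
      linear_combination -r1 + (1 - y x) * e2
    have hgg : g x = (y x - 1 - x - ε x) / 2 + (g x + B x - y x) := by
      simp only [hεdef]; ring
    have hh' : h x = (-2 * g x * (y x - 1) + (g x + B x - 1 - α₁ * x) ^ 2
        - α₃ ^ 2 * (1 - x) ^ 2) / (y x - 1) := by
      rw [eq_div_iff hy1, key]
    simp only [Pi.div_apply]
    rw [hh', hgB, e1]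
    simp only [hηdef, hεdef]
    field_simp
    ring
  set b₃ : ℂ := c₀ + 3 / 2 * a - 1 / 2 with hb₃
  set c₃ : ℂ := a * (α₁ - 1 / 2) with hc₃
  set bm : ℂ := -(a * (a - 1) / κ₀) with hbm
  have hbm0 : bm ≠ 0 := neg_ne_zero.2 (div_ne_zero (mul_ne_zero ha₀ ha₁') hκ₀)
  have tb : Tendsto (fun x => B x - g x - (1 + x) / 2) (𝓝[≠] a) (𝓝 b₃) := by
    have hlim := ((hε.add ((hx.const_add 1).div_const 2)).sub hζ).sub ((hx.const_mul α₁).mul hη)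
    rw [show 0 + (1 + a) / 2 - (1 - a - c₀) - α₁ * a * 0 = b₃ by rw [hb₃]; ring] at hlim
    refine hlim.congr fun x => ?_
    rw [hg]
    simp only [hεdef]
    ring
  have tc : Tendsto (fun x => -h x - α₁ * x + x / 2) (𝓝[≠] a) (𝓝 c₃) := by
    have hlim := (hh.neg.sub (hx.const_mul α₁)).add (hx.div_const 2)
    rwa [show -(a - 2 * α₁ * a) - α₁ * a + a / 2 = c₃ by rw [hc₃]; ring] at hlim
  have hκ0 : ∀ᶠ x in 𝓝[≠] a, D.κ x ≠ 0 := hD.eventually.mono fun x hx => hx.2.2.1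
  have tbm : Tendsto (fun x => 2 * g x / D.κ x) (𝓝[≠] a) (𝓝 bm) := by
    have ht := hx.sub_const a
    have hlim := ((tendsto_sub_pow_mul_of_eq hf hy).add (ht.mul ((((hx.const_add 1).neg.add
      (hζ.const_mul 2)).add (((hx.const_mul α₁).mul hη).const_mul 2)).sub hε))).div hκ hκ₀
    rw [sub_self, zero_mul, add_zero, hfa', neg_div, ← hbm] at hlim
    refine hlim.congr' ?_
    filter_upwards [eventually_ne_nhdsNE a a, hκ0] with x hxa hk
    have hxa' := sub_ne_zero.2 hxa
    simp only [Pi.div_apply]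
    rw [hg]
    field_simp
    ring
  -- `h` is bounded while `κ` has a pole, so the limiting lower left entry is a multiple of `l`.
  have tcm : Tendsto (fun x => h x / D.κ x) (𝓝[≠] a) (𝓝 0) := by
    have hlim := (hh.mul (hx.sub_const a)).div hκ hκ₀
    rw [sub_self, mul_zero, zero_div] at hlim
    refine hlim.congr' ?_
    filter_upwards [eventually_ne_nhdsNE a a, hκ0] with x hxa hk
    have hxa' := sub_ne_zero.2 hxa
    simp only [Pi.div_apply]
    field_simp
  have hrel : ∀ᶠ x in 𝓝[≠] a,
      (-(1 / 2) + (B x - g x - (1 + x) / 2) + (-h x - α₁ * x + x / 2)) ^ 2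
        + (D.κ x * (2 * B x - y x - 1 - x) + D.κ x * (-h x + x - 2 * (α₁ * x)))
          * (2 * g x / D.κ x + h x / D.κ x) = α₃ ^ 2 * (1 - x) ^ 2 ∧
      (-(1 / 2) * x ^ 2 + (B x - g x - (1 + x) / 2) * x + (-h x - α₁ * x + x / 2)) ^ 2
        + (D.κ x * (2 * B x - y x - 1 - x) * x + D.κ x * (-h x + x - 2 * (α₁ * x)))
          * (2 * g x / D.κ x * x + h x / D.κ x) = α₂ ^ 2 * (x * (x - 1)) ^ 2 := by
    filter_upwards [hD.eventually, hω] with x ⟨x0, x1, hk, _, hr⟩ ⟨hωx, hC⟩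
    rw [hasResidueEigenvalues_iff x0 x1] at hr
    exact residue_relations_sqrt hk hC hωx hr.2.2 hr.2.1
  -- The upper right coefficients have the indeterminate form `κ ε` with `κ → ∞`. Their limits are
  -- instead read off from the relations at `1` and `x`, where the lower left entry has the nonzero
  -- limits `bm` and `bm a`.
  have tP : Tendsto (fun x => D.κ x * (2 * B x - y x - 1 - x)
      + D.κ x * (-h x + x - 2 * (α₁ * x))) (𝓝[≠] a)
      (𝓝 ((α₃ ^ 2 * (1 - a) ^ 2 - (-(1 / 2) + b₃ + c₃) ^ 2) / (bm + 0))) := by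
    have hden := tbm.add tcm
    have hne : bm + 0 ≠ 0 := by rwa [add_zero]
    refine (((((hx.const_sub 1).pow 2).const_mul (α₃ ^ 2)).sub
      (((tb.const_add (-(1 / 2))).add tc).pow 2)).div hden hne).congr' ?_
    filter_upwards [hrel, hden.eventually_ne hne] with x hr hd
    simp only [Pi.div_apply]
    rw [div_eq_iff hd, ← hr.1]
    ring
  have tQ : Tendsto (fun x => D.κ x * (2 * B x - y x - 1 - x) * x
      + D.κ x * (-h x + x - 2 * (α₁ * x))) (𝓝[≠] a)
      (𝓝 ((α₂ ^ 2 * (a * (a - 1)) ^ 2 - (-(1 / 2) * a ^ 2 + b₃ * a + c₃) ^ 2)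
        / (bm * a + 0))) := by
    have hden := (tbm.mul hx).add tcm
    have hne : bm * a + 0 ≠ 0 := by rw [add_zero]; exact mul_ne_zero hbm0 ha₀
    refine (((((hx.mul (hx.sub_const 1)).pow 2).const_mul (α₂ ^ 2)).sub
      ((((hx.pow 2).const_mul (-(1 / 2))).add (tb.mul hx)).add tc |>.pow 2)).div
        hden hne).congr' ?_
    filter_upwards [hrel, hden.eventually_ne hne] with x hr hd
    simp only [Pi.div_apply]
    rw [div_eq_iff hd, ← hr.2]
    ring
  obtain ⟨tbp, tcp⟩ := tendsto_coeffs_of_values ha₁ tP tQ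
  set P : ℂ := (α₃ ^ 2 * (1 - a) ^ 2 - (-(1 / 2) + b₃ + c₃) ^ 2) / (bm + 0) with hP
  set Q : ℂ := (α₂ ^ 2 * (a * (a - 1)) ^ 2 - (-(1 / 2) * a ^ 2 + b₃ * a + c₃) ^ 2)
    / (bm * a + 0) with hQ
  set bp : ℂ := (Q - P) / (a - 1) with hbp
  set cp : ℂ := P - (Q - P) / (a - 1) with hcp
  have r1 : (-(1 / 2) + b₃ + c₃) ^ 2 + (bp + cp) * bm = α₃ ^ 2 * (1 - a) ^ 2 := by
    have : bp + cp = P := by rw [hbp, hcp]; ring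
    rw [this, hP, add_zero]
    field_simp
    ring
  have ra : (-(1 / 2) * a ^ 2 + b₃ * a + c₃) ^ 2 + (bp * a + cp) * (bm * a)
      = α₂ ^ 2 * (a * (a - 1)) ^ 2 := by
    have : bp * a + cp = Q := by rw [hbp, hcp]; field_simp; ring
    rw [this, hQ, add_zero]
    field_simp
    ring
  refine ⟨b₃, c₃, bp, cp, bm, rfl, rfl, ?_, ?_, rfl, ?_, fun U s hU U0 U1 Ua hs => ⟨?_, ?_⟩, ?_⟩
  · rw [hbp, hQ, hP, hbm, hb₃, hc₃, add_zero, add_zero]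
    field_simp
    ring
  · rw [hcp, hQ, hP, hbm, hb₃, hc₃, add_zero, add_zero]
    field_simp
    ring
  · rw [hasResidueEigenvalues_iff ha₀ ha₁]
    refine ⟨by rw [hc₃]; ring, ?_, ?_⟩
    · rw [add_zero]; exact ra
    · rw [add_zero]; exact r1
  · filter_upwards [hκ0] with x hk l hl
    have hs2 := hs.2 l hl
    have hl0 : l ≠ 0 := fun h => U0 (h ▸ hl)
    rw [schlesinger₁, Matrix.det_smul, Matrix.det_fin_two_of, Fintype.card_fin, inv_pow, hs2]
    field_simp
    ring
  · intro l hl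
    have l0 : l ≠ 0 := fun h => U0 (h ▸ hl)
    have l1 : l ≠ 1 := fun h => U1 (h ▸ hl)
    have la : l ≠ a := fun h => Ua (h ▸ hl)
    refine (tendsto_fuchsMatrix_numerator l0 l1 la tendsto_const_nhds tb tc tbp tcp tbm
      tcm).congr' ?_
    filter_upwards [hκ0, hω, hx.eventually_ne la.symm] with x hk ⟨hωx, hC⟩ hxl
    rw [laxMatrix_eq]
    exact (gaugeTransform_sqrt hs hU hl hk l0 l1 hxl.symm _ _ _ _ hC hωx).symm
  · have := equivalentToHeun_of_linear (N := numerator (-(1 / 2)) b₃ c₃ bp cp bm 0)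
      (i := 1) (j := 0) (e₁ := α₁ - 1 / 2) (e₂ := α₂)
      (e₃ := α₃) (d := -(1 / 2)) (b := -b₃) (c := -c₃) (g := bm) (h₁ := bp) (h₀ := cp)
      (α := 2 - (α₁ + α₂ + α₃)) (β := -(α₁ + α₂ + α₃)) one_ne_zero ha₀ ha₁ hbm0
      (fun l => by
        refine ⟨?_, ?_, ?_, ?_⟩ <;> simp [numerator] <;> ring)
      (by rw [hc₃]; ring) (by linear_combination r1) (by linear_combination ra) (by ring)
      (by ring) rfl
    rw [show 1 - 2 * α₁ = -2 * (α₁ - 1 / 2) by ring]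
    convert this using 1
    simp only [accessoryBase]
    ring

/-! ### Double poles -/

/-- `formula_p` for `δ = 1/2`, ordered by powers of `1/y`. At a double pole `v` is of order `(x -
a)⁻¹`, so `v/2` is singular, `v²/(4y)` bounded, and the rest tends to zero. -/
theorem expansion_p {α₁ α₂ α₃ x y p z v : ℂ} (hy₀ : y ≠ 0) (hy₁ : y - 1 ≠ 0) (hyx : y - x ≠ 0)
    (hz : z = -y ^ 2 / 2 + y * v / 2)
    (hp : 2 * (1 / 2) * p = (1 / 2) ^ 2 * (1 + x - 3 * y) - z ^ 2 / (y * (y - 1) * (y - x))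
      + α₁ ^ 2 * x / y + α₃ ^ 2 * (1 - x) / (y - 1) + α₂ ^ 2 * (x * (x - 1)) / (y - x)) :
    y + p = v / 2 - v ^ 2 * y⁻¹ / 4 + y⁻¹ * (v * (1 + x) / 2 - v ^ 2 * y⁻¹ * (1 + x) / 4
      - ((1 + x) ^ 2 - x - x * (1 + x) * y⁻¹) / ((1 - 1 * y⁻¹) * (1 - x * y⁻¹))
        * (1 - v * y⁻¹) ^ 2 / 4
      + α₁ ^ 2 * x + α₃ ^ 2 * (1 - x) / (1 - 1 * y⁻¹)
      + α₂ ^ 2 * (x * (x - 1)) / (1 - x * y⁻¹)) := by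
  have e1 : 1 - 1 * y⁻¹ = (y - 1) / y := by field_simp
  have e2 : 1 - x * y⁻¹ = (y - x) / y := by field_simp
  have hp' : p = (1 / 2) ^ 2 * (1 + x - 3 * y) - z ^ 2 / (y * (y - 1) * (y - x))
      + α₁ ^ 2 * x / y + α₃ ^ 2 * (1 - x) / (y - 1) + α₂ ^ 2 * (x * (x - 1)) / (y - x) := by
    rw [← hp]; ring
  rw [hp', hz, e1, e2]
  field_simp
  ring

/-- The relation at `1` solved for `κ κt`, times `t = x - a`. The two terms `β² f / t²` cancel to
leading order, and the cross term leaves `-V β`. -/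
theorem expansion_lower_entry {V β f t ρ r : ℂ} (ht : t ≠ 0) (hft : f - t ^ 2 ≠ 0) :
    ((-(β ^ 2 * f) + t ^ 4 * ρ) / t ^ 2
      + ((-(1 / 2) + (V / (2 * t) + β) + -(β * f) / t ^ 2) ^ 2 - r) / ((f - t ^ 2) / t ^ 2)) * t
    = -(V * β) + t * ((β ^ 2 * f - 2 * (β - 1 / 2) * β * f + (V / 2 + t * (β - 1 / 2)) ^ 2
      - t ^ 2 * r - t * (V * β)) / (f - t ^ 2) + t ^ 2 * ρ) := by
  obtain ⟨d, hd⟩ : ∃ d, d = f - t ^ 2 := ⟨_, rfl⟩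
  obtain rfl : f = d + t ^ 2 := by rw [hd]; ring
  rw [← hd] at hft ⊢
  field_simp
  ring

section DoublePole

variable {α₁ α₂ α₃ a : ℂ} {y f : ℂ → ℂ} {D : LaxData}

set_option maxHeartbeats 400000 in
/-- The expansion of the coefficients of the associated system at a double pole. -/
theorem double_pole_expansion (ha₀ : a ≠ 0) (ha₁ : a ≠ 1) (hf : AnalyticAt ℂ f a) (hf0 : f a ≠ 0)
    (hy : ∀ᶠ x in 𝓝[≠] a, y x = f x / (x - a) ^ 2)
    (hD : IsAssociatedSystem (1 / 2) α₁ α₂ α₃ a y D) :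
    ∃ V β S k : ℂ → ℂ,
      Tendsto V (𝓝[≠] a) (𝓝 (-2 * (a * (a - 1)))) ∧
      Tendsto β (𝓝[≠] a) (𝓝 (-(a * (a - 1)) ^ 2 / f a)) ∧
      Tendsto S (𝓝[≠] a) (𝓝 (-(a * (a - 1)) * (1 + a) / f a)) ∧
      Tendsto k (𝓝[≠] a) (𝓝 (-((a * (a - 1)) ^ 2 / f a) ^ 2)) ∧
      ∀ᶠ x in 𝓝[≠] a,
        β x = -(V x ^ 2 / (4 * f x)) + (x - a) * S x ∧
        y x + D.p x = V x / (2 * (x - a)) + β x ∧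
        -(1 / 2) * y x ^ 2 - D.p x * y x + D.z x = -(β x * f x) / (x - a) ^ 2 ∧
        D.κ x * D.ω x * (x - a) ^ 2 = -(β x ^ 2 * f x) + (x - a) ^ 4 * (α₁ ^ 2 * x ^ 2 / f x) ∧
        D.κ x * D.κt x * (x - a) = -(V x * β x) + (x - a) * k x := by
  have hx := tendsto_id_nhdsNE a
  have ht : Tendsto (fun x => x - a) (𝓝[≠] a) (𝓝 0) := by simpa using hx.sub_const a
  have hfl : Tendsto f (𝓝[≠] a) (𝓝 (f a)) :=
    hf.continuousAt.tendsto.mono_left nhdsWithin_le_nhds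
  have hf'l : Tendsto (deriv f) (𝓝[≠] a) (𝓝 (deriv f a)) :=
    hf.deriv.continuousAt.tendsto.mono_left nhdsWithin_le_nhds
  have hη := tendsto_inv_of_eq two_ne_zero hf hf0 hy
  have hy0 := eventually_ne_zero_of_eq hf hf0 hy
  have n1 : ∀ᶠ x in 𝓝[≠] a, 1 - 1 * (y x)⁻¹ ≠ 0 := eventually_inv_ne hη tendsto_const_nhds
  have nx : ∀ᶠ x in 𝓝[≠] a, 1 - x * (y x)⁻¹ ≠ 0 := eventually_inv_ne hη hx
  set V : ℂ → ℂ := fun x => x * (x - 1) * ((x - a) * (deriv f x / f x) - 2) + (x - a) with hVdef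
  have hV : Tendsto V (𝓝[≠] a) (𝓝 (-2 * (a * (a - 1)))) := by
    have := ((hx.mul (hx.sub_const 1)).mul (((ht.mul (hf'l.div hfl hf0))).sub_const 2)).add ht
    rwa [show a * (a - 1) * (0 * (deriv f a / f a) - 2) + 0 = -2 * (a * (a - 1)) by ring] at this
  -- The coefficient of `x - a` in `β`. It is kept explicitly because the leading orders cancel in
  -- `double_pole_case`.
  set S : ℂ → ℂ := fun x => V x * (1 + x) / 2 / f x + (x - a) / f x *
    (-(V x ^ 2 / f x * (1 + x) / 4)
      - ((1 + x) ^ 2 - x - x * (1 + x) * (y x)⁻¹) / ((1 - 1 * (y x)⁻¹) * (1 - x * (y x)⁻¹))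
        * (1 - (x - a) * V x / f x) ^ 2 / 4
      + α₁ ^ 2 * x + α₃ ^ 2 * (1 - x) / (1 - 1 * (y x)⁻¹)
      + α₂ ^ 2 * (x * (x - 1)) / (1 - x * (y x)⁻¹)) with hSdef
  have hS : Tendsto S (𝓝[≠] a) (𝓝 (-(a * (a - 1)) * (1 + a) / f a)) := by
    have u1 := (hη.const_mul 1).const_sub 1
    have ux := (hx.mul hη).const_sub 1
    have := (((hV.mul (hx.const_add 1)).div_const 2).div hfl hf0).add
      ((ht.div hfl hf0).mul ((((((((hV.pow 2).div hfl hf0).mul (hx.const_add 1)).div_const 4).neg.sub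
        ((((((hx.const_add 1).pow 2).sub hx).sub ((hx.mul (hx.const_add 1)).mul hη)).div (u1.mul ux)
          (by simp)).mul ((((ht.mul hV).div hfl hf0).const_sub 1).pow 2) |>.div_const 4)).add
        (hx.const_mul (α₁ ^ 2))).add (((hx.const_sub 1).const_mul (α₃ ^ 2)).div u1 (by simp))).add
        (((hx.mul (hx.sub_const 1)).const_mul (α₂ ^ 2)).div ux (by simp))))
    rw [zero_div, zero_mul, add_zero] at this
    rwa [show -2 * (a * (a - 1)) * (1 + a) / 2 / f a = -(a * (a - 1)) * (1 + a) / f a by ring]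
      at this
  set β : ℂ → ℂ := fun x => -(V x ^ 2 / (4 * f x)) + (x - a) * S x with hβdef
  have hβ : Tendsto β (𝓝[≠] a) (𝓝 (-(a * (a - 1)) ^ 2 / f a)) := by
    have := ((hV.pow 2).div (hfl.const_mul 4) (by simpa using hf0)).neg.add (ht.mul hS)
    rwa [zero_mul, add_zero, show -((-2 * (a * (a - 1))) ^ 2 / (4 * f a))
      = -(a * (a - 1)) ^ 2 / f a by field_simp; norm_num] at this
  set k : ℂ → ℂ := fun x => (β x ^ 2 * f x - 2 * (β x - 1 / 2) * β x * f x
    + (V x / 2 + (x - a) * (β x - 1 / 2)) ^ 2 - (x - a) ^ 2 * (α₃ ^ 2 * (1 - x) ^ 2)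
    - (x - a) * (V x * β x)) / (f x - (x - a) ^ 2)
    + (x - a) ^ 2 * (α₁ ^ 2 * x ^ 2 / f x) with hkdef
  have hfd : Tendsto (fun x => f x - (x - a) ^ 2) (𝓝[≠] a) (𝓝 (f a - 0 ^ 2)) := hfl.sub (ht.pow 2)
  have hfd0 : f a - 0 ^ 2 ≠ 0 := by simpa using hf0
  have hk : Tendsto k (𝓝[≠] a) (𝓝 (-((a * (a - 1)) ^ 2 / f a) ^ 2)) := by
    have := ((((((hβ.pow 2).mul hfl).sub ((((hβ.sub_const (1 / 2)).const_mul 2).mul hβ).mul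
      hfl)).add (((hV.div_const 2).add (ht.mul (hβ.sub_const (1 / 2)))).pow 2)).sub
      ((ht.pow 2).mul (((hx.const_sub 1).pow 2).const_mul (α₃ ^ 2)))).sub
      (ht.mul (hV.mul hβ))).div hfd hfd0 |>.add
      ((ht.pow 2).mul (((hx.pow 2).const_mul (α₁ ^ 2)).div hfl hf0))
    refine this.trans (le_of_eq ?_)
    congr 1
    simp only [ne_eq, OfNat.ofNat_ne_zero, not_false_eq_true, zero_pow, zero_mul, sub_zero,
      add_zero]
    field_simp
    ring
  refine ⟨V, β, S, k, hV, hβ, hS, hk, ?_⟩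
  clear_value k β S V
  filter_upwards [hD.eventually, hy, hy0, n1, nx, eventually_hasDerivAt_of_eq_div_pow hf hy,
    eventually_ne_nhdsNE a a, hfl.eventually_ne hf0, hfd.eventually_ne hfd0]
    with x ⟨x0, x1, hκ, hz, hr⟩ hyx hy0 n1 nx hdy hxa hfx hfdx
  have hxa' := sub_ne_zero.2 hxa
  have hy1 : y x - 1 ≠ 0 := fun h => n1 (by field_simp; rw [h, mul_zero])
  have hyx' : y x - x ≠ 0 := fun h => nx (by field_simp; rw [h, mul_zero])
  have hz' : D.z x = -y x ^ 2 / 2 + y x * (V x / (x - a)) / 2 := by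
    rw [hz, hdy, hyx]
    simp only [hVdef]
    field_simp
    push_cast
    ring
  have hp := expansion_p hy0 hy1 hyx' hz'
    (formula_p x0 x1 hy0 (sub_ne_zero.1 hy1) (sub_ne_zero.1 hyx') hr)
  have hη : (y x)⁻¹ = (x - a) ^ 2 / f x := by rw [hyx, inv_div]
  have I1 : y x + D.p x = V x / (2 * (x - a)) + β x := by
    rw [hp]
    simp only [hβdef, hSdef]
    generalize α₃ ^ 2 * (1 - x) / (1 - 1 * (y x)⁻¹) = q1
    generalize α₂ ^ 2 * (x * (x - 1)) / (1 - x * (y x)⁻¹) = q2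
    generalize ((1 + x) ^ 2 - x - x * (1 + x) * (y x)⁻¹) /
      ((1 - 1 * (y x)⁻¹) * (1 - x * (y x)⁻¹)) = q3
    rw [hη]
    field_simp
    ring
  have I2 : -(1 / 2) * y x ^ 2 - D.p x * y x + D.z x = -(β x * f x) / (x - a) ^ 2 := by
    rw [show D.p x = V x / (2 * (x - a)) + β x - y x by rw [← I1]; ring, hz', hyx]
    field_simp
    ring
  rw [hasResidueEigenvalues_iff x0 x1, I2,
    show 2 * (1 / 2) * y x + D.p x = V x / (2 * (x - a)) + β x by rw [← I1]; ring] at hr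
  obtain ⟨r0, -, r1⟩ := hr
  have I3 : D.κ x * D.ω x * (x - a) ^ 2
      = -(β x ^ 2 * f x) + (x - a) ^ 4 * (α₁ ^ 2 * x ^ 2 / f x) := by
    have hω : D.κ x * D.ω x = (α₁ ^ 2 * x ^ 2 - (-(β x * f x) / (x - a) ^ 2) ^ 2) / y x := by
      rw [eq_div_iff hy0]; linear_combination r0
    rw [hω, hyx]
    field_simp
    ring
  refine ⟨by rw [hβdef], I1, I2, I3, ?_⟩
  have hκt : D.κ x * D.κt x = D.κ x * D.ω x
      + ((-(1 / 2) + (V x / (2 * (x - a)) + β x) + -(β x * f x) / (x - a) ^ 2) ^ 2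
        - α₃ ^ 2 * (1 - x) ^ 2) / (y x - 1) := by
    rw [← sub_eq_iff_eq_add', eq_div_iff hy1]
    linear_combination -r1
  have hω : D.κ x * D.ω x
      = (-(β x ^ 2 * f x) + (x - a) ^ 4 * (α₁ ^ 2 * x ^ 2 / f x)) / (x - a) ^ 2 := by
    rw [← I3]; field_simp
  rw [hκt, hω, show y x - 1 = (f x - (x - a) ^ 2) / (x - a) ^ 2 by rw [hyx]; field_simp]
  rw [hkdef]
  exact expansion_lower_entry hxa' hfdx

theorem double_pole_case (ha₀ : a ≠ 0) (ha₁ : a ≠ 1) (hf : AnalyticAt ℂ f a) (hf0 : f a ≠ 0)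
    (hy : ∀ᶠ x in 𝓝[≠] a, y x = f x / (x - a) ^ 2)
    (hD : IsAssociatedSystem (1 / 2) α₁ α₂ α₃ a y D) {κ₀ : ℂ} (hκ₀ : κ₀ ≠ 0)
    (hκ : Tendsto D.κ (𝓝[≠] a) (𝓝 κ₀)) :
    ∃ b₃ c₃ cp bm cm : ℂ,
      b₃ = a + 1 - a ^ 2 * (a - 1) ^ 2 / (2 * f a) ∧
      c₃ = a ^ 4 * (a - 1) ^ 4 / (12 * f a ^ 2)
        + a ^ 2 * (a - 1) ^ 2 * (a + 1) / (6 * f a)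
        + 1 / 12 * (a ^ 2 * (1 - 4 * α₂ ^ 2)
          + a * (-7 - 4 * α₁ ^ 2 + 4 * α₃ ^ 2 + 4 * α₂ ^ 2) + 1 - 4 * α₃ ^ 2) ∧
      cp = -(κ₀ * f a / (a ^ 2 * (a - 1) ^ 2)) ∧
      HasResidueEigenvalues (numerator (-(3 / 2)) b₃ c₃ 0 cp bm cm) a α₁ α₂ α₃ ∧
      (∀ᶠ x in 𝓝[≠] a, ∀ l : ℂ, (schlesinger₂ y D x l).det = 1) ∧
      (∀ l : ℂ, l ≠ 0 → l ≠ 1 → l ≠ a →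
        Tendsto (fun x => gaugeTransform (schlesinger₂ y D x) (laxMatrix (1 / 2) y D x) l)
          (𝓝[≠] a) (𝓝 (fuchsMatrix (numerator (-(3 / 2)) b₃ c₃ 0 cp bm cm) a l))) ∧
      EquivalentToHeun (fuchsMatrix (numerator (-(3 / 2)) b₃ c₃ 0 cp bm cm) a) 0 α₁ α₂ α₃
        a (1 - 2 * α₁) (1 - 2 * α₃) (1 - 2 * α₂)
        (3 / 2 - (α₁ + α₂ + α₃)) (1 / 2 - (α₁ + α₂ + α₃))
        (-(accessoryBase α₁ α₂ α₃ a (3 / 2) + 2 * b₃)) := by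
  obtain ⟨V, β, S, k, hV, hβ, hS, hk, hev⟩ := double_pole_expansion ha₀ ha₁ hf hf0 hy hD
  have ha₁' := sub_ne_zero.2 ha₁
  have hx := tendsto_id_nhdsNE a
  have ht : Tendsto (fun x => x - a) (𝓝[≠] a) (𝓝 0) := by simpa using hx.sub_const a
  have hfl : Tendsto f (𝓝[≠] a) (𝓝 (f a)) :=
    hf.continuousAt.tendsto.mono_left nhdsWithin_le_nhds
  set b : ℂ := a * (a - 1) with hb
  have hb0 : b ≠ 0 := mul_ne_zero ha₀ ha₁'
  set Ω : ℂ → ℂ := fun x => -(β x ^ 2 * f x) + (x - a) ^ 4 * (α₁ ^ 2 * x ^ 2 / f x) with hΩdef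
  set K : ℂ → ℂ := fun x => -(V x * β x) + (x - a) * k x with hKdef
  have hΩ : Tendsto Ω (𝓝[≠] a) (𝓝 (-(b ^ 4 / f a))) := by
    have := ((hβ.pow 2).mul hfl).neg.add
      ((ht.pow 4).mul (((hx.pow 2).const_mul (α₁ ^ 2)).div hfl hf0))
    refine this.trans (le_of_eq ?_)
    congr 1
    field_simp
    ring
  have hK : Tendsto K (𝓝[≠] a) (𝓝 (-(2 * b ^ 3 / f a))) := by
    have := (hV.mul hβ).neg.add (ht.mul hk)
    refine this.trans (le_of_eq ?_)
    congr 1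
    field_simp
    ring
  have hΩ0 : -(b ^ 4 / f a) ≠ 0 := neg_ne_zero.2 (div_ne_zero (pow_ne_zero 4 hb0) hf0)
  have hK0 : -(2 * b ^ 3 / f a) ≠ 0 :=
    neg_ne_zero.2 (div_ne_zero (mul_ne_zero two_ne_zero (pow_ne_zero 3 hb0)) hf0)
  have hpt : ∀ᶠ x in 𝓝[≠] a, D.κt x ≠ 0 ∧ D.ω x ≠ 0 ∧ D.κt x = K x / (D.κ x * (x - a)) ∧
      D.ω x = Ω x / (D.κ x * (x - a) ^ 2) ∧ D.κ x ≠ 0 ∧ x - a ≠ 0 ∧ Ω x ≠ 0 ∧ K x ≠ 0 := by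
    filter_upwards [hev, eventually_ne_nhdsNE a a, hΩ.eventually_ne hΩ0, hK.eventually_ne hK0,
      hD.eventually] with x ⟨_, _, _, e3, e4⟩ hxa hΩx hKx ⟨_, _, hκx, _⟩
    have hxa' := sub_ne_zero.2 hxa
    have e3' : D.ω x = Ω x / (D.κ x * (x - a) ^ 2) := by
      rw [eq_div_iff (mul_ne_zero hκx (pow_ne_zero 2 hxa'))]
      linear_combination e3
    have e4' : D.κt x = K x / (D.κ x * (x - a)) := by
      rw [eq_div_iff (mul_ne_zero hκx hxa')]
      linear_combination e4
    refine ⟨?_, ?_, e4', e3', hκx, hxa', hΩx, hKx⟩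
    · rw [e4']; exact div_ne_zero hKx (mul_ne_zero hκx hxa')
    · rw [e3']; exact div_ne_zero hΩx (mul_ne_zero hκx (pow_ne_zero 2 hxa'))
  set r : ℂ → ℂ := fun x => -(1 / 3) * (2 * D.p x + 2 * y x - 2 * D.yt x + x + 1) with hr
  have hR : ∀ x, schlesinger₂ y D x = fun l => !![0, -(D.κt x / 2)⁻¹; D.κt x / 2, l + r x] := by
    intro x
    funext l
    simp only [schlesinger₂, hr, inv_div]
  have hgk : ∀ x, D.κt x = (1 - 2 * (-(1 / 2))) * (D.κt x / 2) := fun x => by ring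
  have hrk : ∀ᶠ x in 𝓝[≠] a, 2 * (D.κt x / 2) * ((2 * (1 / 2) * y x + D.p x) + -(1 / 2) * r x)
      + -D.ω x + 2 * D.κt x * r x = -(D.κt x / 2 * (1 + x)) := by
    filter_upwards [hpt] with x ⟨hκt, _⟩
    simp only [hr, LaxData.yt]
    field_simp
    ring
  have hη : Tendsto (fun x => D.κt x / D.ω x) (𝓝[≠] a) (𝓝 0) := by
    have := (ht.mul hK).div hΩ hΩ0
    rw [zero_mul, zero_div] at this
    refine this.congr' ?_
    filter_upwards [hpt] with x ⟨_, _, e1, e2, hκx, hxa, hΩx, hKx⟩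
    rw [e1, e2]
    simp only [Pi.div_apply]
    field_simp
  have hG : Tendsto (fun x => -(-D.ω x) / (D.κt x / 2) ^ 2) (𝓝[≠] a)
      (𝓝 (-(κ₀ * f a / (a ^ 2 * (a - 1) ^ 2)))) := by
    have := ((hκ.const_mul 4).mul hΩ).div (hK.pow 2) (pow_ne_zero 2 hK0)
    rw [show 4 * κ₀ * -(b ^ 4 / f a) / (-(2 * b ^ 3 / f a)) ^ 2
      = -(κ₀ * f a / (a ^ 2 * (a - 1) ^ 2)) by
        rw [← mul_pow, ← hb]; field_simp; norm_num] at this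
    refine this.congr' ?_
    filter_upwards [hpt] with x ⟨_, _, e1, e2, hκx, hxa, hΩx, hKx⟩
    rw [e1, e2]
    simp only [Pi.div_apply]
    field_simp
    norm_num
  -- The shift `r` cancels. What remains is `2 ω/κt - f₁ - (κt/ω) f₀`, with `f₁, f₀` the old
  -- diagonal coefficients; each term has order `(x - a)⁻¹`, and these parts must cancel.
  have hB : Tendsto (fun x => (-(-D.ω x + r x * D.κt x) / (D.κt x / 2)
      - (2 * (1 / 2) * y x + D.p x)) + D.κt x / D.ω x * (-(r x * -D.ω x) / (D.κt x / 2)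
      - (-(1 / 2) * y x ^ 2 - D.p x * y x + D.z x))) (𝓝[≠] a)
      (𝓝 (a + 1 - a ^ 2 * (a - 1) ^ 2 / (2 * f a))) := by
    have hnum : Tendsto (fun x => (2 * β x ^ 3 * f x ^ 2 * S x
        - 3 / 2 * (V x * β x ^ 2 * f x * k x) + (x - a) * (β x * f x * k x ^ 2)
        + (x - a) ^ 3 * (α₁ ^ 2 * x ^ 2 / f x) * (1 / 2 * (V x ^ 2 * β x) - 4 * (β x ^ 2 * f x)
          - 1 / 2 * (V x * (x - a) * k x) + 2 * (x - a) ^ 4 * (α₁ ^ 2 * x ^ 2 / f x)))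
          / (K x * Ω x) - β x) (𝓝[≠] a) (𝓝 (a + 1 - a ^ 2 * (a - 1) ^ 2 / (2 * f a))) := by
      have hρ := ((hx.pow 2).const_mul (α₁ ^ 2)).div hfl hf0
      have := ((((((((hβ.pow 3).const_mul 2).mul (hfl.pow 2)).mul hS).sub
        ((((hV.mul (hβ.pow 2)).mul hfl).mul hk).const_mul (3 / 2))).add
        (ht.mul ((hβ.mul hfl).mul (hk.pow 2)))).add (((ht.pow 3).mul hρ).mul
        (((((hV.pow 2).mul hβ).const_mul (1 / 2)).sub (((hβ.pow 2).mul hfl).const_mul 4)).sub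
        (((hV.mul ht).mul hk).const_mul (1 / 2)) |>.add
          (((ht.pow 4).const_mul 2).mul hρ)))).div (hK.mul hΩ) (mul_ne_zero hK0 hΩ0)).sub hβ
      refine this.trans (le_of_eq ?_)
      congr 1
      rw [← mul_pow a, ← hb]
      field_simp
      ring
    refine hnum.congr' ?_
    filter_upwards [hpt, hev, hfl.eventually_ne hf0]
      with x ⟨n1, n2, e1, e2, hκx, hxa, hΩx, hKx⟩ ⟨f0, f1, f2, f3, f4⟩ hfx
    rw [f2, show 2 * (1 / 2) * y x + D.p x = V x / (2 * (x - a)) + β x by rw [← f1]; ring]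
    have hlhs : (-(-D.ω x + r x * D.κt x) / (D.κt x / 2) - (V x / (2 * (x - a)) + β x))
        + D.κt x / D.ω x * (-(r x * -D.ω x) / (D.κt x / 2) - -(β x * f x) / (x - a) ^ 2)
        = (2 * Ω x ^ 2 - V x * K x * Ω x / 2 + β x * f x * K x ^ 2) / ((x - a) * (K x * Ω x))
          - β x := by
      rw [e1, e2]
      field_simp
      ring
    rw [hlhs]
    congr 1
    rw [div_eq_div_iff (mul_ne_zero hKx hΩx) (mul_ne_zero hxa (mul_ne_zero hKx hΩx))]
    -- To leading order the left side is `(β³ f / 2)(V² + 4 f β)`, and `V² + 4 f β = 4 f (x - a) S`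
    -- by the definition of `β`. This supplies the missing factor `x - a`.
    have hcore : 2 * Ω x ^ 2 - V x * K x * Ω x / 2 + β x * f x * K x ^ 2 = (x - a) *
        (2 * β x ^ 3 * f x ^ 2 * S x
        - 3 / 2 * (V x * β x ^ 2 * f x * k x) + (x - a) * (β x * f x * k x ^ 2)
        + (x - a) ^ 3 * (α₁ ^ 2 * x ^ 2 / f x) * (1 / 2 * (V x ^ 2 * β x) - 4 * (β x ^ 2 * f x)
          - 1 / 2 * (V x * (x - a) * k x) + 2 * (x - a) ^ 4 * (α₁ ^ 2 * x ^ 2 / f x))) := by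
      have hVS : V x ^ 2 = 4 * f x * ((x - a) * S x - β x) := by
        rw [f0]; field_simp; ring
      simp only [hΩdef, hKdef]
      linear_combination (β x ^ 3 * f x / 2) * hVS
    rw [hcore]
    ring
  obtain ⟨c, h₁, h₀, hc, hres, hlim, hH⟩ := exists_limit_upper (e := 3 / 2)
    (α₁ := α₁) (α₂ := α₂) (α₃ := α₃) (η := fun x => D.κt x / D.ω x) ha₀ ha₁ (by norm_num)
    (neg_ne_zero.2 (div_ne_zero (mul_ne_zero hκ₀ hf0)
      (mul_ne_zero (pow_ne_zero 2 ha₀) (pow_ne_zero 2 ha₁'))))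
    (by
      filter_upwards [hD.eventually, hpt, hrk] with x ⟨x0, x1, _, _, hx⟩ ⟨n1, _⟩ hrkx
      have := hasResidueEigenvalues_lower (div_ne_zero n1 two_ne_zero) x0 x1 (hgk x) hrkx hx
      rwa [show (-(1 / 2) - 1 : ℂ) = -(3 / 2) by norm_num] at this)
    (by
      filter_upwards [hpt] with x ⟨n1, n2, _⟩
      field_simp) hη hG hB
  refine ⟨_, c, _, h₁, h₀, rfl, ?_, rfl, hres, ?_, fun l l0 l1 la => ?_,
    hH _ _ _ (by ring) (by ring) (by ring)⟩
  · rw [hc]; field_simp; ring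
  · filter_upwards [hpt] with x ⟨hκt, _⟩ l
    rw [hR, Matrix.det_fin_two_of]
    field_simp
    ring
  · refine (hlim l l0 l1 la).congr' ?_
    filter_upwards [hpt, hrk, hx.eventually_ne la.symm] with x ⟨hκt, _⟩ hrkx hxl
    rw [hR, laxMatrix_eq, gaugeTransform_lower (div_ne_zero hκt two_ne_zero) l0 l1 hxl.symm
      _ _ _ _ _ _ _ (hgk x) hrkx, show (-(1 / 2) - 1 : ℂ) = -(3 / 2) by norm_num]

end DoublePole

end PVIHeun

/-! ### Assembly of the four cases. -/

open PVIHeun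
theorem theorem2p1 (δ α₁ α₂ α₃ a : ℂ) (hδ : δ ≠ 0)
    (hα₁ : ∀ n : ℤ, 2 * α₁ ≠ n) (hα₂ : ∀ n : ℤ, 2 * α₂ ≠ n) (hα₃ : ∀ n : ℤ, 2 * α₃ ≠ n)
    (ha₀ : a ≠ 0) (ha₁ : a ≠ 1) (y : ℂ → ℂ)
    (hy : MeromorphicAt y a) (hpole : meromorphicOrderAt y a < 0)
    (hPVI : ∀ᶠ x in 𝓝[≠] a, PainleveVI δ α₁ α₂ α₃ y x) :
    -- the simple poles
    (δ ≠ 1 / 2 → meromorphicOrderAt y a = ((-1 : ℤ) : WithTop ℤ) ∧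
      ∃ σ c₀ : ℂ, (σ = 1 ∨ σ = -1) ∧ HasSimplePoleExpansion δ σ a c₀ y ∧
        ∀ D : LaxData, IsAssociatedSystem δ α₁ α₂ α₃ a y D → ∃ κ₀ : ℂ, κ₀ ≠ 0 ∧
          -- regular case
          (σ = 1 →
            Tendsto (fun x => D.κ x / (x - a)) (𝓝[≠] a) (𝓝 κ₀) ∧
            ∃ b₃ c₃ cp bm cm : ℂ,
              b₃ = c₀ * (2 * δ - 1) + 1 - a ∧
              c₃ = 1 / (2 * δ) * ((δ - 1 - c₀ * (2 * δ - 1)) ^ 2 - a * α₁ ^ 2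
                + (a - 1) * α₃ ^ 2 - a * (a - 1) * α₂ ^ 2
                + a * (δ ^ 2 - 2 - 2 * c₀ * (2 * δ ^ 2 + δ - 1)) + a ^ 2 * (δ + 1) ^ 2) ∧
              cp = -κ₀ * (a * (a - 1) / (2 * δ - 1)) ∧
              HasResidueEigenvalues (numerator (-δ) b₃ c₃ 0 cp bm cm) a α₁ α₂ α₃ ∧
              (∀ l : ℂ, l ≠ 0 → l ≠ 1 → l ≠ a →
                Tendsto (fun x => laxMatrix δ y D x l) (𝓝[≠] a)
                  (𝓝 (fuchsMatrix (numerator (-δ) b₃ c₃ 0 cp bm cm) a l))) ∧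
              EquivalentToHeun (fuchsMatrix (numerator (-δ) b₃ c₃ 0 cp bm cm) a) 0 α₁ α₂ α₃
                a (1 - 2 * α₁) (1 - 2 * α₃) (1 - 2 * α₂)
                (δ - (α₁ + α₂ + α₃)) (2 - δ - (α₁ + α₂ + α₃))
                (-(accessoryBase α₁ α₂ α₃ a δ + b₃ * (2 * δ - 1)))) ∧
          -- both singular cases
          (σ = -1 →
            Tendsto (fun x => D.κ x * (x - a)) (𝓝[≠] a) (𝓝 κ₀) ∧
            ∀ l : ℂ, l ≠ 0 → l ≠ 1 → l ≠ a →
              Tendsto (fun x => ‖laxMatrix δ y D x l 0 1‖) (𝓝[≠] a) atTop) ∧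
          -- generic singular case
          (σ = -1 → δ ≠ 1 →
            ∃ b₃ c₃ cm bp cp : ℂ,
              b₃ = a - 1 + c₀ * (2 * δ - 1) ∧
              c₃ = 1 / (2 * (δ - 1)) * (a ^ 2 * ((δ - 2) ^ 2 - α₂ ^ 2)
                + a * (-α₁ ^ 2 + α₃ ^ 2 + α₂ ^ 2 + (δ - 1) ^ 2 - 2
                  - c₀ * (4 * (δ - 1) ^ 2 - 2 * δ))
                - α₃ ^ 2 + (δ - c₀ * (2 * δ - 1)) ^ 2) ∧
              cm = -(a * (a - 1) * (2 * δ - 1) / κ₀) ∧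
              HasResidueEigenvalues (numerator (1 - δ) b₃ c₃ bp cp 0 cm) a α₁ α₂ α₃ ∧
              (∀ᶠ x in 𝓝[≠] a, ∀ l : ℂ, (schlesinger₀ δ y D x l).det = 1) ∧
              (∀ l : ℂ, l ≠ 0 → l ≠ 1 → l ≠ a →
                Tendsto (fun x => gaugeTransform (schlesinger₀ δ y D x) (laxMatrix δ y D x) l)
                  (𝓝[≠] a) (𝓝 (fuchsMatrix (numerator (1 - δ) b₃ c₃ bp cp 0 cm) a l))) ∧
              EquivalentToHeun (fuchsMatrix (numerator (1 - δ) b₃ c₃ bp cp 0 cm) a) 1 α₁ α₂ α₃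
                a (1 - 2 * α₁) (1 - 2 * α₃) (1 - 2 * α₂)
                (1 + δ - (α₁ + α₂ + α₃)) (1 - δ - (α₁ + α₂ + α₃))
                (-(accessoryBase α₁ α₂ α₃ a (δ - 1) + b₃ * (2 * δ - 1)))) ∧
          -- special singular case
          (σ = -1 → δ = 1 →
            ∃ b₃ c₃ bp cp bm : ℂ,
              b₃ = c₀ + 3 / 2 * a - 1 / 2 ∧
              c₃ = a * (α₁ - 1 / 2) ∧
              bp = κ₀ / (a * (a - 1)) * (a ^ 2 * (1 - α₂ ^ 2)
                - a * (2 + α₁ ^ 2 - α₃ ^ 2 - α₂ ^ 2 - 2 * c₀) - α₃ ^ 2 + (c₀ - 1) ^ 2) ∧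
              cp = κ₀ * (-α₃ ^ 2 + α₂ ^ 2 + (a + 1) / (a - 1) * α₁ ^ 2
                + 2 * α₁ * (c₀ / (a - 1) + 1)) ∧
              bm = -(a * (a - 1) / κ₀) ∧
              HasResidueEigenvalues (numerator (-(1 / 2)) b₃ c₃ bp cp bm 0) a
                (α₁ - 1 / 2) α₂ α₃ ∧
              (∀ (U : Set ℂ) (s : ℂ → ℂ), IsOpen U → 0 ∉ U → 1 ∉ U → a ∉ U → IsSqrtBranch s U →
                (∀ᶠ x in 𝓝[≠] a, ∀ l ∈ U, (schlesinger₁ α₁ y D s x l).det = 1) ∧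
                ∀ l ∈ U, Tendsto
                  (fun x => gaugeTransform (schlesinger₁ α₁ y D s x) (laxMatrix δ y D x) l)
                  (𝓝[≠] a) (𝓝 (fuchsMatrix (numerator (-(1 / 2)) b₃ c₃ bp cp bm 0) a l))) ∧
              EquivalentToHeun (fuchsMatrix (numerator (-(1 / 2)) b₃ c₃ bp cp bm 0) a) 1
                (α₁ - 1 / 2) α₂ α₃
                a (1 - 2 * α₁) (1 - 2 * α₃) (1 - 2 * α₂)
                (2 - (α₁ + α₂ + α₃)) (-(α₁ + α₂ + α₃))
                (-(b₃ - 1 / 2 * (a + 1) + accessoryBase α₁ α₂ α₃ a 0)))) ∧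
    -- the double poles
    (δ = 1 / 2 → meromorphicOrderAt y a = ((-2 : ℤ) : WithTop ℤ) ∧
      ∃ cd : ℂ, cd ≠ 0 ∧ HasDoublePoleExpansion a cd y ∧
        ∀ D : LaxData, IsAssociatedSystem δ α₁ α₂ α₃ a y D → ∃ κ₀ : ℂ, κ₀ ≠ 0 ∧
          Tendsto D.κ (𝓝[≠] a) (𝓝 κ₀) ∧
          (∀ l : ℂ, l ≠ 0 → l ≠ 1 → l ≠ a →
            Tendsto (fun x => ‖laxMatrix δ y D x l 0 1‖) (𝓝[≠] a) atTop) ∧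
          ∃ b₃ c₃ cp bm cm : ℂ,
            b₃ = a + 1 - a ^ 2 * (a - 1) ^ 2 / (2 * cd) ∧
            c₃ = a ^ 4 * (a - 1) ^ 4 / (12 * cd ^ 2)
              + a ^ 2 * (a - 1) ^ 2 * (a + 1) / (6 * cd)
              + 1 / 12 * (a ^ 2 * (1 - 4 * α₂ ^ 2)
                + a * (-7 - 4 * α₁ ^ 2 + 4 * α₃ ^ 2 + 4 * α₂ ^ 2) + 1 - 4 * α₃ ^ 2) ∧
            cp = -(κ₀ * cd / (a ^ 2 * (a - 1) ^ 2)) ∧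
            HasResidueEigenvalues (numerator (-(3 / 2)) b₃ c₃ 0 cp bm cm) a α₁ α₂ α₃ ∧
            (∀ᶠ x in 𝓝[≠] a, ∀ l : ℂ, (schlesinger₂ y D x l).det = 1) ∧
            (∀ l : ℂ, l ≠ 0 → l ≠ 1 → l ≠ a →
              Tendsto (fun x => gaugeTransform (schlesinger₂ y D x) (laxMatrix δ y D x) l)
                (𝓝[≠] a) (𝓝 (fuchsMatrix (numerator (-(3 / 2)) b₃ c₃ 0 cp bm cm) a l))) ∧
            EquivalentToHeun (fuchsMatrix (numerator (-(3 / 2)) b₃ c₃ 0 cp bm cm) a) 0 α₁ α₂ α₃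
              a (1 - 2 * α₁) (1 - 2 * α₃) (1 - 2 * α₂)
              (3 / 2 - (α₁ + α₂ + α₃)) (1 / 2 - (α₁ + α₂ + α₃))
              (-(accessoryBase α₁ α₂ α₃ a (3 / 2) + 2 * b₃))) := by
  obtain ⟨n, f, hn, hord, hf, hf0, hfy⟩ := exists_eventuallyEq_div_pow hy hpole
  obtain ⟨hsimple, hdouble⟩ := painleveVI_pole ha₀ ha₁ hn hf hf0 hfy hPVI
  have ha₁' := sub_ne_zero.2 ha₁
  refine ⟨fun hδh => ?_, fun hδh => ?_⟩
  · obtain ⟨rfl, hsq⟩ := hsimple hδh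
    obtain ⟨σ, hσ, hfa⟩ : ∃ σ : ℂ, (σ = 1 ∨ σ = -1) ∧
        2 * (δ - 1 / 2) * f a = σ * (a * (a - 1)) := by
      rcases sq_eq_sq_iff_eq_or_eq_neg.1 hsq with h | h
      · exact ⟨1, Or.inl rfl, by rw [h]; ring⟩
      · exact ⟨-1, Or.inr rfl, by rw [h]; ring⟩
    refine ⟨hord, σ, deriv f a, hσ, hasSimplePoleExpansion_of_eq hδh hf hfa hfy, fun D hD => ?_⟩
    obtain ⟨κ₀, hκ₀, hκ, hκ'⟩ := exists_tendsto_gauge_of_simplePole hσ ha₀ ha₁ hf hfa hfy hD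
    refine ⟨κ₀, hκ₀, fun h => ?_, fun h => ?_, fun h hδ₁ => ?_, fun h hδ₁ => ?_⟩
    · subst h
      exact ⟨hκ rfl, regular_case hδ hδh ha₀ ha₁ hf hf0 hfa hfy hD hκ₀ (hκ rfl)⟩
    · refine ⟨hκ' h, fun l l0 l1 la => ?_⟩
      -- `κ` and `y` both have a simple pole, so `κ y` has a double one.
      refine tendsto_norm_upper_entry (n := 2) two_ne_zero (mul_ne_zero hκ₀ hf0)
        (tendsto_inv_of_eq one_ne_zero hf hf0 hfy) (eventually_ne_zero_of_eq hf hf0 hfy)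
        (((hκ' h).mul (tendsto_sub_pow_mul_of_eq hf hfy)).congr fun x => by ring) l0 l1 la
    · subst h
      exact generic_singular_case hδ₁ hδh ha₀ ha₁ hf hf0 hfa hfy hD hκ₀ (hκ' rfl)
    · subst h hδ₁
      exact special_singular_case ha₀ ha₁ hf hf0 hfa hfy hD hκ₀ (hκ' rfl)
  · obtain rfl := hdouble hδh
    subst hδh
    refine ⟨hord, f a, hf0, tendsto_sub_pow_mul_of_eq hf hfy, fun D hD => ?_⟩
    obtain ⟨κ₀, hκ₀, hκ⟩ : ∃ κ₀ : ℂ, κ₀ ≠ 0 ∧ Tendsto D.κ (𝓝[≠] a) (𝓝 κ₀) :=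
      -- The factor `2δ - 1` vanishes, so `κ` has zero derivative near `a`.
      exists_tendsto_ne_zero_of_logDeriv (φ := fun _ => 0) (s := Set.univ) univ_mem
        (differentiableOn_const 0)
        (hD.mono fun x hx => ⟨hx.2.1, hx.2.2.1.congr_deriv (by ring)⟩)
    refine ⟨κ₀, hκ₀, hκ, fun l l0 l1 la => ?_,
      double_pole_case ha₀ ha₁ hf hf0 hfy hD hκ₀ hκ⟩
    exact tendsto_norm_upper_entry (n := 2) two_ne_zero (mul_ne_zero hκ₀ hf0)
      (tendsto_inv_of_eq two_ne_zero hf hf0 hfy) (eventually_ne_zero_of_eq hf hf0 hfy)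
      ((hκ.mul (tendsto_sub_pow_mul_of_eq hf hfy)).congr fun x => by ring) l0 l1 la
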